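/- **Notation.** An index is a finite sequence $\mathbf k=(k_1,\dots,k_r)$ of positive integers, of depth $r$ and weight $k_1+\cdots+k_r$; it is admissible if it is empty or $k_r>1$, and then $\zeta(\mathbf k)=\sum_{0<n_1<\cdots<n_r}n_1^{-k_1}\cdots n_r^{-k_r}$. Let $I(k,r)$ be the set of indices of weight $k$ and depth $r$. For $\mathbf s\in\mathbb C^r$ let $\mathrm{Li}_{\mathbf s}$ be the holomorphic continuation to $(\mathbb C\setminus\mathbb R_{\ge1})^r$ of $$\mathrm{Li}_{\mathbf s}(z_1,\dots,z_r)=\sum_{0<n_1<\cdots<n_r}\frac{z_1^{n_1}z_2^{n_2-n_1}\cdots z_r^{n_r-n_{r-1}}}{n_1^{s_1}\cdots n_r^{s_r}}\qquad(|z_j|<1),$$ and for indices $\mathbf k,\mathbf l$ of the same depth $r>0$ put $$\eta(\mathbf k;\mathbf l)=\prod_{j=1}^r\frac1{\Gamma(l_j)}\int_{(0,\infty)^r}\frac{\mathrm{Li}_{\mathbf k}(1-e^{t_1+\cdots+t_r},\dots,1-e^{t_r})}{(1-e^{t_1+\cdots+t_r})\cdots(1-e^{t_r})}\prod_{j=1}^r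 t_j^{l_j-1}\,dt_j .$$ Let $\mathcal Z_w$ be the $\mathbb Q$-span of the $\zeta(\mathbf k)$ with $\mathbf k$ admissible of weight $w$, and $\mathcal Y_w$ the $\mathbb Q$-span of the $\eta(\mathbf k;\mathbf l)$ with $\mathbf k,\mathbf l$ of the same positive depth and of total weight $w$. For finite sequences of nonnegative integers, let $\mathbf k^\star$ be the formal sum of all sequences obtained from $\mathbf k$ by replacing some (possibly none) of the commas by plus signs. Let $*$ be the harmonic product: $\varnothing*\mathbf k=\mathbf k*\varnothing=\mathbf k$ and, for $\mathbf k=(\mathbf k',a)$, $\mathbf l=(\mathbf l',b)$, $\mathbf k*\mathbf l=(\mathbf k'*\mathbf l,a)+(\mathbf k*\mathbf l',b)+(\mathbf k'*\mathbf l',a+b)$. Put $(\mathbf k',a)\circledast(\mathbf l',b)=(\mathbf k'*\mathbf l',a+b)$. These operations and $\zeta$ are extended linearly to formal $\mathbb Q$-linear combinations; $\circledast$ is taken from left to right. **Theorem.** For all indices $\mathbf k,\mathbf l$ of the same positive depth, $\mathrm{Li}_{\mathbf k}$ has the stated holomorphic continuation and the integral defining $\eta(\mathbf k;\mathbf l)$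 converges absolutely. (1) Let $k,l,r$ be positive integers with $r\le k$ and $r\le l$. Then $\alpha=(\underbrace{2,\dots,2}_r)\circledast(\underbrace{1,\dots,1}_{k-r},0)^\star\circledast(\underbrace{1,\dots,1}_{l-r},0)^\star$ is a formal sum of admissible indices of weight $k+l$, and $$\sum_{\mathbf k\in I(k,r)}\sum_{\mathbf l\in I(l,r)}\eta(\mathbf k;\mathbf l)=\zeta(\alpha)=\sum_{\substack{m_1>\cdots>m_r>0\\0<a_1\le\cdots\le a_{k-r}\le m_1\\0<b_1\le\cdots\le b_{l-r}\le m_1}}\frac1{m_1^2\cdots m_r^2\,a_1\cdots a_{k-r}\,b_1\cdots b_{l-r}},$$ where the series converges. This number is a nonzero element of $\mathcal Y_{k+l}\cap\mathcal Z_{k+l}$. (2) In particular, $\eta(\underbrace{1,\dots,1}_r;\underbrace{1,\dots,1}_r)=\zeta(\underbrace{2,\dots,2}_r)$ for every $r\ge1$. (3) In particular, for all $k,l\ge1$, $\beta=(\underbrace{1,\dots,1}_k)^\star\circledast(\underbrace{1,\dots,1}_l)^\star$ is a formal sum of admissible indices of weight $k+l$, and $$\eta(k;l)=\zeta(\beta)=\sum_{0<a_1\le\cdots\le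 a_k=b_l\ge\cdots\ge b_1>0}\frac1{a_1\cdots a_k\,b_1\cdots b_l},$$ where the series converges. -/

import Mathlib

open scoped BigOperators

noncomputable section

namespace EtaMZV

/-- The set of `r`-tuples of integers with `0 < n₁ < ⋯ < n_r`. -/
def increasingTuples (r : ℕ) : Set (Fin r → ℕ) :=
  {n | StrictMono n ∧ ∀ j, 0 < n j}

/-! ### Multiple polylogarithms -/

/-- The `n`-th term `z₁ ^ n₁ z₂ ^ (n₂ - n₁) ⋯ z_r ^ (n_r - n_{r-1}) / (n₁ ^ s₁ ⋯ n_r ^ s_r)` of the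
series defining the multiple polylogarithm of `r` variables (with `n₀ = 0`). -/
def polylogTerm {r : ℕ} (s z : Fin r → ℂ) (n : Fin r → ℕ) : ℂ :=
  ∏ j : Fin r, z j ^ (n j - if (j : ℕ) = 0 then 0 else n ⟨(j : ℕ) - 1, by omega⟩) /
    (n j : ℂ) ^ s j

/-- The region `(ℂ ∖ ℝ_{≥ 1}) ^ r` (note that `Complex.slitPlane` is `ℂ ∖ ℝ_{≤ 0}`). -/
def polylogRegion (r : ℕ) : Set (Fin r → ℂ) :=
  {z | ∀ j, 1 - z j ∈ Complex.slitPlane}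

/-- `F` is the holomorphic continuation to `(ℂ ∖ ℝ_{≥ 1}) ^ r` of the multiple polylogarithm
`Li_s`, which is given on the unit polydisc by the sum over `0 < n₁ < ⋯ < n_r` of `polylogTerm`.
The region is open and star-shaped about `0`, so `F` is unique there. -/
structure IsPolylogContinuation {r : ℕ} (s : Fin r → ℂ) (F : (Fin r → ℂ) → ℂ) : Prop where
  differentiableOn : DifferentiableOn ℂ F (polylogRegion r)
  hasSum : ∀ z : Fin r → ℂ, (∀ j, ‖z j‖ < 1) →
    HasSum (fun n : increasingTuples r => polylogTerm s z n) (F z)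

open Classical in
/-- The (analytically continued) multiple polylogarithm `Li_s(z)`, for `z` in
`(ℂ ∖ ℝ_{≥ 1}) ^ r`. -/
def polylog {r : ℕ} (s z : Fin r → ℂ) : ℂ :=
  if h : ∃ F, IsPolylogContinuation s F then h.choose z else 0

/-! ### The eta function -/

/-- `1 - exp (t_j + ⋯ + t_r)`. -/
def oneSubExp {r : ℕ} (t : Fin r → ℝ) (j : Fin r) : ℂ :=
  1 - Complex.exp ((∑ i ∈ Finset.Ici j, t i : ℝ) : ℂ)

/-- The integrand in the definition of `η(s'; s)`. -/
def etaIntegrand {r : ℕ} (s' s : Fin r → ℂ) (t : Fin r → ℝ) : ℂ :=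
  polylog s' (oneSubExp t) / (∏ j, oneSubExp t j) * ∏ j, (t j : ℂ) ^ (s j - 1)

/-- The domain of integration `(0, ∞) ^ r`. -/
def posOrthant (r : ℕ) : Set (Fin r → ℝ) :=
  {t | ∀ j, 0 < t j}

/-- `η(s'; s)`, for `s'` in `ℂ ^ r` and `s` in `ℂ ^ r` with `Re s_j > 0`. -/
def eta {r : ℕ} (s' s : Fin r → ℂ) : ℂ :=
  (∏ j, (Complex.Gamma (s j))⁻¹) * ∫ t in posOrthant r, etaIntegrand s' s t

/-- All the ingredients of `eta s' s` make sense: the polylogarithm has its holomorphic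
continuation, and the integral converges absolutely. -/
def EtaWellDefined {r : ℕ} (s' s : Fin r → ℂ) : Prop :=
  (∃ F, IsPolylogContinuation s' F) ∧
    MeasureTheory.IntegrableOn (etaIntegrand s' s) (posOrthant r)

/-- `η(k; l)` for tuples of natural numbers `k` and `l`. -/
def etaNat {r : ℕ} (k l : Fin r → ℕ) : ℂ :=
  eta (fun j => (k j : ℂ)) (fun j => (l j : ℂ))

/-- `I(k, r)`: the tuples of `r` positive integers with sum `k`. -/
def indexSet (k r : ℕ) : Finset (Fin r → ℕ) :=
  {f ∈ Finset.piAntidiag Finset.univ k | ∀ j, 0 < f j}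

/-! ### Multiple zeta values and formal sums of indices

Here a sequence `(k₁, …, k_r)` is written as a list `[k₁, …, k_r]`. The operations are defined for
all sequences of natural numbers, since they are also applied to `(1, …, 1, 0)`. -/

/-- A sequence of positive integers that is empty or has last entry `> 1`. -/
def IsAdmissible (k : List ℕ) : Prop :=
  (∀ x ∈ k, 0 < x) ∧ ∀ x ∈ k.getLast?, 1 < x

/-- The multiple zeta value: the sum over `0 < n₁ < ⋯ < n_r` of `1 / (n₁ ^ k₁ ⋯ n_r ^ k_r)`. -/
def mzv (k : List ℕ) : ℝ :=
  ∑' n : increasingTuples k.length, ∏ j, 1 / ((n : Fin k.length → ℕ) j : ℝ) ^ k.get j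

/-- Formal `ℚ`-linear combinations of sequences. -/
abbrev FormalSum : Type := List ℕ →₀ ℚ

/-- A sequence as a formal sum. -/
def ofIndex (k : List ℕ) : FormalSum := Finsupp.single k 1

/-- The linear extension of `k ↦ ζ(k)`. -/
def zetaLin : FormalSum →ₗ[ℚ] ℝ := Finsupp.linearCombination ℚ mzv

/-- The linear extension of `(k₁, …, k_r) ↦ (k₁, …, k_r, a)`. -/
def snocLin (a : ℕ) : FormalSum →ₗ[ℚ] FormalSum :=
  Finsupp.linearCombination ℚ fun k => ofIndex (k ++ [a])

/-- The linear extension of `(k₁, …, k_r) ↦ (a, k₁, …, k_r)`. -/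
def consLin (a : ℕ) : FormalSum →ₗ[ℚ] FormalSum :=
  Finsupp.linearCombination ℚ fun k => ofIndex (a :: k)

/-- `k^⋆`: the formal sum of all coarsenings of `k`, i.e. of the sequences obtained from
`(k₁, …, k_r)` by replacing some of the `r - 1` commas by plus signs. (For the sequence `k` to be
a refinement of `k'` means that `k'` arises from `k` in this way.) The recursion keeps the first
comma, or replaces it. -/
def starSum : List ℕ → FormalSum
  | [] => ofIndex []
  | [a] => ofIndex [a]
  | a :: b :: k => consLin a (starSum (b :: k)) + starSum ((a + b) :: k)
termination_by k => k.length

/-- The harmonic product `k * l`. -/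
def harmonicProd (k l : List ℕ) : FormalSum :=
  if hk : k = [] then ofIndex l
  else if hl : l = [] then ofIndex k
  else
    snocLin (k.getLast hk) (harmonicProd k.dropLast l)
      + snocLin (l.getLast hl) (harmonicProd k l.dropLast)
      + snocLin (k.getLast hk + l.getLast hl) (harmonicProd k.dropLast l.dropLast)
termination_by k.length + l.length
decreasing_by
  all_goals
    have h1 := List.length_pos_of_ne_nil hk
    have h2 := List.length_pos_of_ne_nil hl
    simp only [List.length_dropLast]
    omega

/-- `k ⊛ l = ((k₁, …, k_{r-1}) * (l₁, …, l_{s-1}), k_r + l_s)`, for nonempty sequences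
`k = (k₁, …, k_r)` and `l = (l₁, …, l_s)`. -/
def circIndex (k l : List ℕ) : FormalSum :=
  snocLin (k.getLastD 0 + l.getLastD 0) (harmonicProd k.dropLast l.dropLast)

/-- The bilinear extension of `⊛` to formal sums. -/
def circ (α β : FormalSum) : FormalSum :=
  Finsupp.linearCombination ℚ
    (fun k => Finsupp.linearCombination ℚ (fun l => circIndex k l) β) α

/-- The formal sum `(2, …, 2) ⊛ (1, …, 1, 0)^⋆ ⊛ (1, …, 1, 0)^⋆` with `r` twos, `k - r` ones and
`l - r` ones. -/
def sumFormulaIndex (k l r : ℕ) : FormalSum :=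
  circ (circ (ofIndex (List.replicate r 2)) (starSum (List.replicate (k - r) 1 ++ [0])))
    (starSum (List.replicate (l - r) 1 ++ [0]))

/-- All sequences that occur in `α` are admissible indices of weight `w`. -/
def IsAdmissibleOfWeight (α : FormalSum) (w : ℕ) : Prop :=
  ∀ k ∈ α.support, IsAdmissible k ∧ k.sum = w

/-- The `ℚ`-linear span of the `ζ(k)` for admissible indices `k` of weight `w`. -/
def zetaSpace (w : ℕ) : Submodule ℚ ℂ :=
  Submodule.span ℚ {x | ∃ k : List ℕ, IsAdmissible k ∧ k.sum = w ∧ x = (mzv k : ℂ)}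

/-- The `ℚ`-linear span of the `η(k; l)` for indices `k` and `l` of the same positive depth, of
total weight `w`. -/
def etaSpace (w : ℕ) : Submodule ℚ ℂ :=
  Submodule.span ℚ {x | ∃ (r : ℕ) (k l : Fin r → ℕ), 0 < r ∧ (∀ j, 0 < k j) ∧ (∀ j, 0 < l j) ∧
    ∑ j, k j + ∑ j, l j = w ∧ x = etaNat k l}

/-- The summation range of the multiple series: triples `(m, a, b)` with
`m₁ > ⋯ > m_r > 0`, `0 < a₁ ≤ ⋯ ≤ a_p ≤ m₁` and `0 < b₁ ≤ ⋯ ≤ b_q ≤ m₁`. -/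
def seriesRange (r p q : ℕ) : Set ((Fin r → ℕ) × (Fin p → ℕ) × (Fin q → ℕ)) :=
  {x | (StrictAnti x.1 ∧ ∀ j, 0 < x.1 j) ∧
    (Monotone x.2.1 ∧ ∀ i, 0 < x.2.1 i ∧ ∀ j : Fin r, (j : ℕ) = 0 → x.2.1 i ≤ x.1 j) ∧
    (Monotone x.2.2 ∧ ∀ i, 0 < x.2.2 i ∧ ∀ j : Fin r, (j : ℕ) = 0 → x.2.2 i ≤ x.1 j)}

/-- `1 / (m₁² ⋯ m_r² a₁ ⋯ a_p b₁ ⋯ b_q)`. -/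
def seriesTerm {r p q : ℕ} (x : (Fin r → ℕ) × (Fin p → ℕ) × (Fin q → ℕ)) : ℝ :=
  1 / ((∏ j, (x.1 j : ℝ) ^ 2) * (∏ i, (x.2.1 i : ℝ)) * ∏ i, (x.2.2 i : ℝ))

/-- Pairs `(a, b)` with `0 < a₁ ≤ ⋯ ≤ a_k = b_l ≥ ⋯ ≥ b₁ > 0`. -/
def pairRange (k l : ℕ) : Set ((Fin k → ℕ) × (Fin l → ℕ)) :=
  {x | (Monotone x.1 ∧ ∀ i, 0 < x.1 i) ∧ (Monotone x.2 ∧ ∀ i, 0 < x.2 i) ∧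
    ∀ (i : Fin k) (j : Fin l), (i : ℕ) + 1 = k → (j : ℕ) + 1 = l → x.1 i = x.2 j}

end EtaMZV

end

open EtaMZV

/-! The proof computes the sum of all the η-values as one absolutely convergent double integral.
Expanding each 1 / (e ^ X - z_j) geometrically and using Gamma integrals gives Li_k(z) = ∏ z_j · ∫ ∏
x_j ^ (k_j - 1) / (k_j - 1)! · ∏ 1 / (e ^ (x_j + ⋯ + x_r) - z_j) dx, and the right side is
holomorphic on the whole region (`isPolylogContinuation_polylogIntegral`). At z_j = 1 - e ^ (t_j + ⋯
+ t_r) the factors z_j cancel and the kernel ∏ 1 / (e ^ X_j + e ^ T_j - 1) appears, symmetric in the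
two sets of variables (`etaNat_eq`).

Summing over the indices of given weight collapses the monomials, by the multinomial theorem, to
powers of x_1 + ⋯ + x_r and of t_1 + ⋯ + t_r (`sum_gammaWeight`). Each factor of the kernel is a
geometric series in (1 - e ^ (-X_j)) (1 - e ^ (-T_j)), which separates x from t. Each half is an
iterated integral that yields one factor 1 / n_j per variable and, by integration by parts, a star
sum 1 / (a_1 ⋯ a_p) below the largest n_j (`lintegral_tailSum`, `integral_pow_mul_expWeight`).
Multiplying the two halves gives the multiple series (`lintegral_etaKernel`).

On the algebraic side every series is cut according to the value n + 1 of its largest variable. For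
fixed n, ⊛ becomes ordinary multiplication (`lastTermLin_circ`) and the coarsenings of (1, …, 1, c)
become a star sum (`lastTermLin_starSum_replicate`). Hence ζ of the formal sum is the same series.
Everything is nonnegative, so sums and integrals are exchanged freely in ℝ≥0∞, and finiteness of the
total gives the convergence of each η-value. -/

noncomputable section

namespace EtaMZV

/-! ### Truncated multiple harmonic sums -/

/-- The sum over `0 < n₁ < ⋯ < n_r ≤ N` of `1 / (n₁ ^ k₁ ⋯ n_r ^ k_r)`, where the list
is `[k_r, …, k₁]`. -/
def harmonicSumRev : List ℕ → ℕ → ℝ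
  | [], _ => 1
  | a :: k, N => ∑ n ∈ Finset.range N, harmonicSumRev k n / ((n : ℝ) + 1) ^ a

/-- The sum over `0 < n₁ < ⋯ < n_r ≤ N` of `1 / (n₁ ^ k₁ ⋯ n_r ^ k_r)`. -/
def harmonicSum (k : List ℕ) (N : ℕ) : ℝ := harmonicSumRev k.reverse N

/-- The part `n_r = n + 1` of the series defining `ζ(k₁, …, k_r)`. -/
def lastTerm (k : List ℕ) (n : ℕ) : ℝ :=
  harmonicSum k.dropLast n / ((n : ℝ) + 1) ^ k.getLastD 0

/-- The linear extension of `harmonicSum · N`. -/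
def harmonicSumLin (N : ℕ) : FormalSum →ₗ[ℚ] ℝ :=
  Finsupp.linearCombination ℚ fun k => harmonicSum k N

/-- The linear extension of `lastTerm · n`. -/
def lastTermLin (n : ℕ) : FormalSum →ₗ[ℚ] ℝ :=
  Finsupp.linearCombination ℚ fun k => lastTerm k n

/-- The sum over `0 < a₁ ≤ ⋯ ≤ a_p ≤ N` of `1 / (a₁ ⋯ a_p)`. -/
def harmonicStar : ℕ → ℕ → ℝ
  | 0, _ => 1
  | p + 1, N => ∑ n ∈ Finset.range N, harmonicStar p (n + 1) / ((n : ℝ) + 1)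

@[simp] theorem harmonicSum_nil (N : ℕ) : harmonicSum [] N = 1 := by
  simp [harmonicSum, harmonicSumRev]

theorem harmonicSum_concat (k : List ℕ) (a N : ℕ) :
    harmonicSum (k ++ [a]) N = ∑ n ∈ Finset.range N, harmonicSum k n / ((n : ℝ) + 1) ^ a := by
  simp [harmonicSum, harmonicSumRev]

theorem harmonicSum_concat_succ (k : List ℕ) (a N : ℕ) :
    harmonicSum (k ++ [a]) (N + 1) =
      harmonicSum (k ++ [a]) N + harmonicSum k N / ((N : ℝ) + 1) ^ a := by
  rw [harmonicSum_concat, harmonicSum_concat, Finset.sum_range_succ]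

theorem harmonicSum_concat_zero (k : List ℕ) (a : ℕ) : harmonicSum (k ++ [a]) 0 = 0 := by
  simp [harmonicSum_concat]

theorem lastTerm_concat (k : List ℕ) (a n : ℕ) :
    lastTerm (k ++ [a]) n = harmonicSum k n / ((n : ℝ) + 1) ^ a := by
  simp [lastTerm]

theorem harmonicSum_nonneg (k : List ℕ) (N : ℕ) : 0 ≤ harmonicSum k N := by
  induction k using List.reverseRecOn generalizing N with
  | nil => simp
  | append_singleton k a ih =>
    rw [harmonicSum_concat]
    exact Finset.sum_nonneg fun n _ => div_nonneg (ih n) (by positivity)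

theorem lastTerm_nonneg (k : List ℕ) (n : ℕ) : 0 ≤ lastTerm k n :=
  div_nonneg (harmonicSum_nonneg _ _) (by positivity)

theorem harmonicStar_nonneg (p N : ℕ) : 0 ≤ harmonicStar p N := by
  induction p generalizing N with
  | zero => simp [harmonicStar]
  | succ p ih => exact Finset.sum_nonneg fun n _ => div_nonneg (ih _) (by positivity)

@[simp] theorem harmonicSumLin_ofIndex (N : ℕ) (k : List ℕ) :
    harmonicSumLin N (ofIndex k) = harmonicSum k N := by
  simp [harmonicSumLin, ofIndex]

@[simp] theorem lastTermLin_ofIndex (n : ℕ) (k : List ℕ) :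
    lastTermLin n (ofIndex k) = lastTerm k n := by
  simp [lastTermLin, ofIndex]

@[simp] theorem snocLin_ofIndex (a : ℕ) (k : List ℕ) :
    snocLin a (ofIndex k) = ofIndex (k ++ [a]) := by
  simp [snocLin, ofIndex]

@[simp] theorem consLin_ofIndex (a : ℕ) (k : List ℕ) :
    consLin a (ofIndex k) = ofIndex (a :: k) := by
  simp [consLin, ofIndex]

/-- Two linear maps on formal sums agree if they agree on sequences. -/
theorem formalSum_hom_ext {M : Type*} [AddCommMonoid M] [Module ℚ M]
    {f g : FormalSum →ₗ[ℚ] M} (h : ∀ k, f (ofIndex k) = g (ofIndex k)) : f = g := by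
  apply Finsupp.lhom_ext'
  intro k
  ext
  exact h k

theorem lastTermLin_snocLin (n a : ℕ) (α : FormalSum) :
    lastTermLin n (snocLin a α) = harmonicSumLin n α / ((n : ℝ) + 1) ^ a := by
  have h : lastTermLin n ∘ₗ snocLin a =
      ((((n : ℝ) + 1) ^ a)⁻¹ • (LinearMap.id : ℝ →ₗ[ℚ] ℝ)) ∘ₗ harmonicSumLin n := by
    refine formalSum_hom_ext fun k => ?_
    simp [lastTerm_concat, div_eq_inv_mul]
  have := LinearMap.congr_fun h α
  simpa [div_eq_inv_mul] using this

theorem harmonicSumLin_snocLin_succ (N a : ℕ) (α : FormalSum) :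
    harmonicSumLin (N + 1) (snocLin a α) =
      harmonicSumLin N (snocLin a α) + harmonicSumLin N α / ((N : ℝ) + 1) ^ a := by
  have h : harmonicSumLin (N + 1) ∘ₗ snocLin a =
      harmonicSumLin N ∘ₗ snocLin a + lastTermLin N ∘ₗ snocLin a := by
    refine formalSum_hom_ext fun k => ?_
    simp [lastTerm_concat, harmonicSum_concat_succ]
  have := LinearMap.congr_fun h α
  simpa [lastTermLin_snocLin] using this

theorem harmonicSumLin_snocLin_zero (a : ℕ) (α : FormalSum) :
    harmonicSumLin 0 (snocLin a α) = 0 := by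
  have h : harmonicSumLin 0 ∘ₗ snocLin a = 0 := by
    refine formalSum_hom_ext fun k => ?_
    simp [harmonicSum_concat_zero]
  exact LinearMap.congr_fun h α

/-! ### Products and star sums under truncation -/

theorem harmonicProd_nil_left (l : List ℕ) : harmonicProd [] l = ofIndex l := by
  rw [harmonicProd]; simp

theorem harmonicProd_nil_right (k : List ℕ) : harmonicProd k [] = ofIndex k := by
  rw [harmonicProd]; aesop

theorem harmonicProd_concat (k l : List ℕ) (a b : ℕ) :
    harmonicProd (k ++ [a]) (l ++ [b]) =
      snocLin a (harmonicProd k (l ++ [b])) + snocLin b (harmonicProd (k ++ [a]) l)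
        + snocLin (a + b) (harmonicProd k l) := by
  rw [harmonicProd]; simp

/-- Truncated harmonic sums turn the harmonic product into a product. -/
theorem harmonicSumLin_harmonicProd (k l : List ℕ) (N : ℕ) :
    harmonicSumLin N (harmonicProd k l) = harmonicSum k N * harmonicSum l N := by
  induction k using List.reverseRecOn generalizing l N with
  | nil => simp [harmonicProd_nil_left]
  | append_singleton k a ihk =>
    induction l using List.reverseRecOn generalizing N with
    | nil => simp [harmonicProd_nil_right]
    | append_singleton l b ihl =>
      rw [harmonicProd_concat]
      -- Both sides vanish at 0. Their increments agree by the discrete product rule ΔA · B + A · ΔB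
      -- + ΔA · ΔB, whose three terms are those of the harmonic product.
      induction N with
      | zero => simp [harmonicSumLin_snocLin_zero, harmonicSum_concat_zero]
      | succ N ihN =>
        simp only [map_add] at ihN
        simp only [map_add, harmonicSumLin_snocLin_succ, harmonicSum_concat_succ, ihk, ihl]
        have hN : ((N : ℝ) + 1) ≠ 0 := by positivity
        rw [pow_add]
        field_simp
        linear_combination ((N : ℝ) + 1) ^ a * ((N : ℝ) + 1) ^ b * ihN

/-- With the largest variable fixed at n + 1 on both sides, the last exponents add and the remaining
truncated sums multiply by the harmonic product. Thus ⊛ is multiplication for each n. -/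
theorem lastTermLin_circ (n : ℕ) (α β : FormalSum) :
    lastTermLin n (circ α β) = lastTermLin n α * lastTermLin n β := by
  have h1 : ∀ k l, lastTermLin n (circIndex k l) = lastTerm k n * lastTerm l n := by
    intro k l
    rw [circIndex, lastTermLin_snocLin, harmonicSumLin_harmonicProd, lastTerm, lastTerm, pow_add]
    ring
  have h2 : ∀ k, lastTermLin n ∘ₗ Finsupp.linearCombination ℚ (fun l => circIndex k l) =
      LinearMap.mulLeft ℚ (lastTerm k n) ∘ₗ lastTermLin n := fun k =>
    formalSum_hom_ext fun l => by
      simp only [LinearMap.comp_apply, lastTermLin_ofIndex, LinearMap.mulLeft_apply, ← h1]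
      simp [ofIndex]
  have h3 : lastTermLin n ∘ₗ Finsupp.linearCombination ℚ
      (fun k => Finsupp.linearCombination ℚ (fun l => circIndex k l) β) =
      LinearMap.mulRight ℚ (lastTermLin n β) ∘ₗ lastTermLin n :=
    formalSum_hom_ext fun k => by
      simp only [LinearMap.comp_apply, lastTermLin_ofIndex, LinearMap.mulRight_apply]
      simpa [ofIndex] using LinearMap.congr_fun (h2 k) β
  exact LinearMap.congr_fun h3 α

theorem consLin_snocLin (a b : ℕ) (α : FormalSum) :
    consLin a (snocLin b α) = snocLin b (consLin a α) := by
  have h : consLin a ∘ₗ snocLin b = snocLin b ∘ₗ consLin a :=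
    formalSum_hom_ext fun k => by simp
  exact LinearMap.congr_fun h α

theorem starSum_singleton (a : ℕ) : starSum [a] = ofIndex [a] := by
  rw [starSum]

theorem starSum_cons_cons (a b : ℕ) (k : List ℕ) :
    starSum (a :: b :: k) = consLin a (starSum (b :: k)) + starSum ((a + b) :: k) := by
  rw [starSum]

/-- The definition of `starSum` decides on the first comma; deciding on the last one instead fits
sums that are split by their largest variable. -/
theorem starSum_concat_concat (k : List ℕ) (a b : ℕ) :
    starSum (k ++ [a, b]) = snocLin b (starSum (k ++ [a])) + starSum (k ++ [a + b]) := by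
  induction h : k.length generalizing k a with
  | zero =>
    obtain rfl := List.length_eq_zero_iff.1 h
    simp [starSum_cons_cons, starSum_singleton]
  | succ m ih =>
    match k, h with
    | [x], _ =>
      have := ih [] (x + a) 
      simp [starSum_cons_cons, starSum_singleton, add_assoc]
      abel
    | x :: y :: k, h =>
      simp only [List.length_cons, add_left_inj] at h
      have h1 := ih (y :: k) a (by simpa using h)
      have h2 := ih ((x + y) :: k) a (by simpa using h)
      simp only [List.cons_append] at h1 h2 ⊢
      rw [starSum_cons_cons, h1, h2, starSum_cons_cons x y (k ++ [a]),
        starSum_cons_cons x y (k ++ [a + b]), map_add, map_add, consLin_snocLin]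
      abel

/-- Raising the last entry by b raises the last entry of every coarsening by b, and that entry is
the exponent of n + 1. -/
theorem lastTermLin_starSum_add (k : List ℕ) (a b n : ℕ) :
    lastTermLin n (starSum (k ++ [a + b])) =
      lastTermLin n (starSum (k ++ [a])) / ((n : ℝ) + 1) ^ b := by
  induction k using List.reverseRecOn generalizing a with
  | nil => simp [starSum_singleton, lastTerm, pow_add, div_mul_eq_div_div]
  | append_singleton k c ih =>
    simp only [List.append_assoc, List.cons_append, List.nil_append]
    rw [starSum_concat_concat, starSum_concat_concat, map_add, map_add, ← add_assoc, ih,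
      lastTermLin_snocLin, lastTermLin_snocLin, pow_add]
    field_simp

/-- Needed for properties that fail for some sequences, such as the empty one or those with
divergent series, so that linear extensionality does not apply. -/
theorem supported_induction {s : Set (List ℕ)} {P : FormalSum → Prop} {α : FormalSum}
    (hα : α ∈ Finsupp.supported ℚ ℚ s) (zero : P 0) (add : ∀ a b, P a → P b → P (a + b))
    (smul : ∀ (c : ℚ) a, P a → P (c • a)) (of : ∀ k ∈ s, P (ofIndex k)) : P α := by
  rw [Finsupp.supported_eq_span_single] at hα
  refine Submodule.span_induction ?_ zero (fun a b _ _ => add a b) (fun c a _ => smul c a) hα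
  rintro _ ⟨k, hk, rfl⟩
  exact of k hk

theorem ofIndex_mem_supported {s : Set (List ℕ)} {k : List ℕ} (hk : k ∈ s) :
    ofIndex k ∈ Finsupp.supported ℚ ℚ s := Finsupp.single_mem_supported ℚ _ hk

/-- The empty sequence must be excluded: its truncated sum is constantly 1, while `lastTerm [] N` is
also 1, by the default last entry 0. -/
theorem harmonicSumLin_succ {α : FormalSum} (hα : α ∈ Finsupp.supported ℚ ℚ {k | k ≠ []})
    (N : ℕ) : harmonicSumLin (N + 1) α = harmonicSumLin N α + lastTermLin N α := by
  refine supported_induction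
    (P := fun α => harmonicSumLin (N + 1) α = harmonicSumLin N α + lastTermLin N α) hα (by simp) ?_ ?_ ?_
  · intro a b ha hb
    simp only [map_add, ha, hb]; ring
  · intro c a ha
    simp only [map_smul, ha, smul_add]
  · intro k hk
    rw [← List.dropLast_append_getLast (l := k) hk]
    simp only [harmonicSumLin_ofIndex, lastTermLin_ofIndex, harmonicSum_concat_succ,
      lastTerm_concat]

theorem harmonicSumLin_zero {α : FormalSum} (hα : α ∈ Finsupp.supported ℚ ℚ {k | k ≠ []}) :
    harmonicSumLin 0 α = 0 := by
  refine supported_induction (P := fun α => harmonicSumLin 0 α = 0) hα (by simp) ?_ ?_ ?_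
  · intro a b ha hb
    simp only [map_add, ha, hb, add_zero]
  · intro c a ha
    simp only [map_smul, ha, smul_zero]
  · intro k hk
    rw [← List.dropLast_append_getLast (l := k) hk]
    simp only [harmonicSumLin_ofIndex, harmonicSum_concat_zero]

theorem harmonicSumLin_eq_sum {α : FormalSum} (hα : α ∈ Finsupp.supported ℚ ℚ {k | k ≠ []})
    (N : ℕ) : harmonicSumLin N α = ∑ n ∈ Finset.range N, lastTermLin n α := by
  induction N with
  | zero => simp [harmonicSumLin_zero hα]
  | succ N ih => rw [harmonicSumLin_succ hα, ih, Finset.sum_range_succ]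

/-! ### Supports of the formal sums -/

/-- Nonempty sequences of weight `w` whose last entry is at least `c` and whose other entries
are positive. -/
def almostAdmissible (w c : ℕ) : Set (List ℕ) :=
  {k | ∃ l a, k = l ++ [a] ∧ (∀ x ∈ l, 0 < x) ∧ c ≤ a ∧ l.sum + a = w}

theorem linearMap_mem_supported {s t : Set (List ℕ)} (f : FormalSum →ₗ[ℚ] FormalSum)
    (h : ∀ k ∈ s, f (ofIndex k) ∈ Finsupp.supported ℚ ℚ t) {α : FormalSum}
    (hα : α ∈ Finsupp.supported ℚ ℚ s) : f α ∈ Finsupp.supported ℚ ℚ t := by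
  refine supported_induction (P := fun α => f α ∈ Finsupp.supported ℚ ℚ t) hα (by simp) ?_ ?_ h
  · intro a b ha hb
    rw [map_add]; exact add_mem ha hb
  · intro c a ha
    rw [map_smul]; exact Submodule.smul_mem _ _ ha

theorem starSum_mem_supported (k : List ℕ) (a : ℕ) (hk : ∀ x ∈ k, 0 < x) :
    starSum (k ++ [a]) ∈ Finsupp.supported ℚ ℚ (almostAdmissible (k.sum + a) a) := by
  induction k using List.reverseRecOn generalizing a with
  | nil =>
    simp only [List.nil_append, starSum_singleton]
    exact ofIndex_mem_supported ⟨[], a, by simp⟩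
  | append_singleton k c ih =>
    simp only [List.mem_append, List.mem_singleton] at hk
    have hk' : ∀ x ∈ k, 0 < x := fun x hx => hk x (Or.inl hx)
    simp only [List.append_assoc, List.cons_append, List.nil_append]
    rw [starSum_concat_concat]
    refine add_mem (linearMap_mem_supported _ ?_ (ih c hk')) ?_
    · rintro _ ⟨l, d, rfl, hl, hcd, hs⟩
      rw [snocLin_ofIndex]
      refine ofIndex_mem_supported ⟨l ++ [d], a, rfl, ?_, le_rfl, ?_⟩
      · have := hk c (Or.inr rfl)
        intro x hx
        rcases List.mem_append.1 hx with hx | hx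
        · exact hl x hx
        · rw [List.mem_singleton.1 hx]; omega
      · simp; omega
    · refine Finsupp.supported_mono ?_ (ih (c + a) hk')
      rintro _ ⟨l, d, rfl, hl, hcd, hs⟩
      exact ⟨l, d, rfl, hl, by omega, by simp; omega⟩

theorem harmonicProd_mem_supported (k l : List ℕ) (hk : ∀ x ∈ k, 0 < x) (hl : ∀ x ∈ l, 0 < x) :
    harmonicProd k l ∈
      Finsupp.supported ℚ ℚ {m : List ℕ | (∀ x ∈ m, 0 < x) ∧ m.sum = k.sum + l.sum} := by
  induction k using List.reverseRecOn generalizing l with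
  | nil =>
    rw [harmonicProd_nil_left]
    exact ofIndex_mem_supported ⟨hl, by simp⟩
  | append_singleton k a ihk =>
    induction l using List.reverseRecOn with
    | nil =>
      rw [harmonicProd_nil_right]
      exact ofIndex_mem_supported ⟨hk, by simp⟩
    | append_singleton l b ihl =>
      simp only [List.mem_append, List.mem_singleton] at hk hl
      have hk' : ∀ x ∈ k, 0 < x := fun x hx => hk x (Or.inl hx)
      have hl' : ∀ x ∈ l, 0 < x := fun x hx => hl x (Or.inl hx)
      have ha := hk a (Or.inr rfl)
      have hb := hl b (Or.inr rfl)
      rw [harmonicProd_concat]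
      refine add_mem (add_mem ?_ ?_) ?_
      · refine linearMap_mem_supported _ ?_ (ihk (l ++ [b]) hk' (by simpa using hl))
        rintro m ⟨hm, hs⟩
        rw [snocLin_ofIndex]
        refine ofIndex_mem_supported ⟨?_, by simp at hs ⊢; omega⟩
        simp only [List.mem_append, List.mem_singleton]
        rintro x (hx | rfl)
        exacts [hm x hx, ha]
      · refine linearMap_mem_supported _ ?_ (ihl hl')
        rintro m ⟨hm, hs⟩
        rw [snocLin_ofIndex]
        refine ofIndex_mem_supported ⟨?_, by simp at hs ⊢; omega⟩
        simp only [List.mem_append, List.mem_singleton]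
        rintro x (hx | rfl)
        exacts [hm x hx, hb]
      · refine linearMap_mem_supported _ ?_ (ihk l hk' hl')
        rintro m ⟨hm, hs⟩
        rw [snocLin_ofIndex]
        refine ofIndex_mem_supported ⟨?_, by simp at hs ⊢; omega⟩
        simp only [List.mem_append, List.mem_singleton]
        rintro x (hx | rfl)
        exacts [hm x hx, by omega]

/-- Lower bounds for the last entries add. So 2 + 0 + 0 and 1 + 1 both reach the bound 2 needed for
admissibility, although factors ending in 0 or 1 are not admissible. -/
theorem circ_mem_supported {w v c d : ℕ} {α β : FormalSum}
    (hα : α ∈ Finsupp.supported ℚ ℚ (almostAdmissible w c))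
    (hβ : β ∈ Finsupp.supported ℚ ℚ (almostAdmissible v d)) :
    circ α β ∈ Finsupp.supported ℚ ℚ (almostAdmissible (w + v) (c + d)) := by
  refine linearMap_mem_supported _ ?_ hα
  rintro _ ⟨k, a, rfl, hk, hca, hs⟩
  simp only [ofIndex, Finsupp.linearCombination_single, one_smul]
  refine linearMap_mem_supported _ ?_ hβ
  rintro _ ⟨l, b, rfl, hl, hdb, hs'⟩
  simp only [ofIndex, Finsupp.linearCombination_single, one_smul, circIndex]
  refine linearMap_mem_supported _ ?_
    (harmonicProd_mem_supported _ _ (by simpa using hk) (by simpa using hl))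
  rintro m ⟨hm, hm'⟩
  rw [snocLin_ofIndex]
  refine ofIndex_mem_supported ⟨m, _, rfl, hm, ?_, ?_⟩
  · simp; omega
  · simp at hm' ⊢; omega

theorem isAdmissibleOfWeight_of_mem_supported {w c : ℕ} (hc : 2 ≤ c) {α : FormalSum}
    (hα : α ∈ Finsupp.supported ℚ ℚ (almostAdmissible w c)) : IsAdmissibleOfWeight α w := by
  intro k hk
  obtain ⟨l, a, rfl, hl, hca, hs⟩ := hα hk
  refine ⟨⟨?_, ?_⟩, by simpa using hs⟩
  · intro x hx
    rcases List.mem_append.1 hx with hx | hx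
    · exact hl x hx
    · rw [List.mem_singleton.1 hx]; omega
  · simp; omega

theorem almostAdmissible_subset_ne_nil (w c : ℕ) : almostAdmissible w c ⊆ {k | k ≠ []} := by
  rintro _ ⟨l, a, rfl, -⟩
  simp

/-- Keeping the last comma gives the terms whose next variable is below n + 1; merging it gives the
terms where that variable equals n + 1. Together they replace < by ≤, which is the recursion of
`harmonicStar`. -/
theorem lastTermLin_starSum_replicate (p c n : ℕ) :
    lastTermLin n (starSum (List.replicate p 1 ++ [c])) =
      harmonicStar p (n + 1) / ((n : ℝ) + 1) ^ c := by
  induction p generalizing c n with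
  | zero => simp [starSum_singleton, harmonicStar, lastTerm]
  | succ p ih =>
    have hα := Finsupp.supported_mono (almostAdmissible_subset_ne_nil _ _)
      (starSum_mem_supported (List.replicate p 1) 1 (by simp))
    rw [List.replicate_succ', List.append_assoc]
    simp only [List.cons_append, List.nil_append]
    rw [starSum_concat_concat, map_add, lastTermLin_starSum_add, lastTermLin_snocLin, ← add_div,
      ← harmonicSumLin_succ hα, harmonicSumLin_eq_sum hα, harmonicStar]
    simp [ih]

theorem replicate_two_mem_supported (r : ℕ) (hr : 0 < r) :
    ofIndex (List.replicate r 2) ∈ Finsupp.supported ℚ ℚ (almostAdmissible (2 * r) 2) := by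
  obtain ⟨r, rfl⟩ := Nat.exists_eq_succ_of_ne_zero hr.ne'
  refine ofIndex_mem_supported ⟨List.replicate r 2, 2, List.replicate_succ', by simp, le_rfl, ?_⟩
  simp; omega

theorem sumFormulaIndex_mem_supported (k l r : ℕ) (hr : 0 < r) (hk : r ≤ k) (hl : r ≤ l) :
    sumFormulaIndex k l r ∈ Finsupp.supported ℚ ℚ (almostAdmissible (k + l) 2) := by
  have := circ_mem_supported (circ_mem_supported (replicate_two_mem_supported r hr)
    (starSum_mem_supported (List.replicate (k - r) 1) 0 (by simp)))
    (starSum_mem_supported (List.replicate (l - r) 1) 0 (by simp))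
  convert! this using 3
  simp; omega

theorem circ_starSum_mem_supported (k l : ℕ) (hk : 0 < k) (hl : 0 < l) :
    circ (starSum (List.replicate k 1)) (starSum (List.replicate l 1)) ∈
      Finsupp.supported ℚ ℚ (almostAdmissible (k + l) 2) := by
  obtain ⟨k, rfl⟩ := Nat.exists_eq_succ_of_ne_zero hk.ne'
  obtain ⟨l, rfl⟩ := Nat.exists_eq_succ_of_ne_zero hl.ne'
  have := circ_mem_supported (starSum_mem_supported (List.replicate k 1) 1 (by simp))
    (starSum_mem_supported (List.replicate l 1) 1 (by simp))
  simpa [← List.replicate_succ'] using this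

theorem lastTermLin_sumFormulaIndex (k l r n : ℕ) :
    lastTermLin n (sumFormulaIndex k l r) =
      lastTerm (List.replicate r 2) n * harmonicStar (k - r) (n + 1) *
        harmonicStar (l - r) (n + 1) := by
  rw [sumFormulaIndex, lastTermLin_circ, lastTermLin_circ, lastTermLin_starSum_replicate,
    lastTermLin_starSum_replicate]
  simp

theorem lastTermLin_circ_starSum (k l n : ℕ) :
    lastTermLin n
      (circ (starSum (List.replicate (k + 1) 1)) (starSum (List.replicate (l + 1) 1))) =
      lastTerm [2] n * harmonicStar k (n + 1) * harmonicStar l (n + 1) := by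
  rw [lastTermLin_circ, List.replicate_succ', List.replicate_succ', lastTermLin_starSum_replicate,
    lastTermLin_starSum_replicate]
  simp only [lastTerm, List.dropLast_singleton, harmonicSum_nil, List.getLastD_cons,
    List.getLastD_nil]
  field_simp

open scoped ENNReal

/-! ### Sums over increasing tuples -/

/-- The set of `r`-tuples of integers with `0 < n₁ < ⋯ < n_r ≤ N`. -/
def boundedTuples (r N : ℕ) : Set (Fin r → ℕ) :=
  {n | StrictMono n ∧ ∀ j, 0 < n j ∧ n j ≤ N}

theorem strictMono_snoc_iff {r : ℕ} (n : Fin r → ℕ) (N : ℕ) :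
    StrictMono (Fin.snoc n N : Fin (r + 1) → ℕ) ↔ StrictMono n ∧ ∀ j, n j < N := by
  constructor
  · intro h
    refine ⟨fun i j hij => ?_, fun j => ?_⟩
    · simpa using h (Fin.castSucc_lt_castSucc_iff.2 hij)
    · simpa using h (Fin.castSucc_lt_last j)
  · rintro ⟨h, h'⟩ i j hij
    induction i using Fin.lastCases with
    | last => exact absurd hij (not_lt.2 (Fin.le_last j))
    | cast i =>
      induction j using Fin.lastCases with
      | last => simpa using h' i
      | cast j => simpa using h (Fin.castSucc_lt_castSucc_iff.1 hij)

theorem monotone_snoc_iff {r : ℕ} (n : Fin r → ℕ) (N : ℕ) :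
    Monotone (Fin.snoc n N : Fin (r + 1) → ℕ) ↔ Monotone n ∧ ∀ j, n j ≤ N := by
  constructor
  · intro h
    refine ⟨fun i j hij => ?_, fun j => ?_⟩
    · simpa using h (Fin.castSucc_le_castSucc_iff.2 hij)
    · simpa using h (Fin.le_last j.castSucc)
  · rintro ⟨h, h'⟩ i j hij
    induction j using Fin.lastCases with
    | last =>
      induction i using Fin.lastCases with
      | last => rfl
      | cast i => simpa using h' i
    | cast j =>
      induction i using Fin.lastCases with
      | last => exact absurd hij (not_le.2 (Fin.castSucc_lt_last j))
      | cast i => simpa using h (Fin.castSucc_le_castSucc_iff.1 hij)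

theorem forall_snoc_iff {r : ℕ} (P : ℕ → Prop) (n : Fin r → ℕ) (N : ℕ) :
    (∀ j, P ((Fin.snoc n N : Fin (r + 1) → ℕ) j)) ↔ (∀ j, P (n j)) ∧ P N := by
  rw [Fin.forall_fin_succ']
  simp

/-- Nonnegative series are handled in ℝ≥0∞, where rearrangement needs no summability;
`hasSum_of_tsum_ofReal` returns to ℝ once the total is known to be finite. -/
theorem tsum_snoc {r : ℕ} (f : (Fin (r + 1) → ℕ) → ℝ≥0∞) :
    ∑' n, f n = ∑' N : ℕ, ∑' n : Fin r → ℕ, f (Fin.snoc n N) := by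
  rw [← (Fin.snocEquiv fun _ : Fin (r + 1) => ℕ).tsum_eq, ENNReal.tsum_prod']
  rfl

theorem tsum_increasingTuples_succ {r : ℕ} (f : (Fin (r + 1) → ℕ) → ℝ≥0∞) :
    ∑' n : increasingTuples (r + 1), f n =
      ∑' N : ℕ, ∑' n : boundedTuples r N, f (Fin.snoc (n : Fin r → ℕ) (N + 1)) := by
  rw [tsum_subtype, tsum_snoc, tsum_eq_zero_add' ENNReal.summable]
  have h0 : ∀ n : Fin r → ℕ, (Fin.snoc n 0 : Fin (r + 1) → ℕ) ∉ increasingTuples (r + 1) := by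
    rintro n ⟨-, h⟩
    simpa using h (Fin.last r)
  simp only [Set.indicator_of_notMem (h0 _), tsum_zero, zero_add]
  congr 1 with N
  rw [tsum_subtype (boundedTuples r N) fun n => f (Fin.snoc n (N + 1))]
  congr 1 with n
  have : (Fin.snoc n (N + 1) : Fin (r + 1) → ℕ) ∈ increasingTuples (r + 1) ↔
      n ∈ boundedTuples r N := by
    simp only [increasingTuples, boundedTuples, Set.mem_ofPred_eq, strictMono_snoc_iff,
      forall_snoc_iff (0 < ·), forall_and, Nat.lt_succ_iff]
    simp
    tauto
  classical
  simp only [Set.indicator_apply, this]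

theorem tsum_boundedTuples_succ {r : ℕ} (M : ℕ) (f : (Fin (r + 1) → ℕ) → ℝ≥0∞) :
    ∑' n : boundedTuples (r + 1) M, f n = ∑ N ∈ Finset.range M,
      ∑' n : boundedTuples r N, f (Fin.snoc (n : Fin r → ℕ) (N + 1)) := by
  rw [tsum_subtype, tsum_snoc, tsum_eq_zero_add' ENNReal.summable]
  have h0 : ∀ n : Fin r → ℕ, (Fin.snoc n 0 : Fin (r + 1) → ℕ) ∉ boundedTuples (r + 1) M := by
    rintro n ⟨-, h⟩
    simpa using (h (Fin.last r)).1
  simp only [Set.indicator_of_notMem (h0 _), tsum_zero, zero_add]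
  have key : ∀ N n, (Fin.snoc n (N + 1) : Fin (r + 1) → ℕ) ∈ boundedTuples (r + 1) M ↔
      n ∈ boundedTuples r N ∧ N < M := by
    intro N n
    simp only [boundedTuples, Set.mem_ofPred_eq, strictMono_snoc_iff,
      forall_snoc_iff (fun x => 0 < x ∧ x ≤ M), Nat.lt_succ_iff]
    constructor
    · rintro ⟨⟨h1, h2⟩, h3, h4⟩
      exact ⟨⟨h1, fun j => ⟨(h3 j).1, h2 j⟩⟩, by omega⟩
    · rintro ⟨⟨h1, h2⟩, h3⟩
      exact ⟨⟨h1, fun j => (h2 j).2⟩, fun j => ⟨(h2 j).1, (h2 j).2.trans h3.le⟩, by omega⟩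
  rw [tsum_eq_sum (s := Finset.range M)]
  · refine Finset.sum_congr rfl fun N hN => ?_
    rw [tsum_subtype (boundedTuples r N) fun n => f (Fin.snoc n (N + 1))]
    congr 1 with n
    classical
    simp only [Set.indicator_apply, key, Finset.mem_range.1 hN, and_true]
  · intro N hN
    rw [Finset.mem_range] at hN
    refine ENNReal.tsum_eq_zero.2 fun n => Set.indicator_of_notMem ?_ _
    rw [key]; tauto

/-- The harmonic sum as a sum over tuples. -/
theorem tsum_boundedTuples_eq_harmonicSum {r : ℕ} (f : Fin r → ℕ) (N : ℕ) :
    ∑' n : boundedTuples r N, ENNReal.ofReal (∏ j, 1 / ((n : Fin r → ℕ) j : ℝ) ^ f j) =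
      ENNReal.ofReal (harmonicSum (List.ofFn f) N) := by
  induction r generalizing N with
  | zero =>
    rw [tsum_subtype (boundedTuples 0 N) fun n => ENNReal.ofReal (∏ j, 1 / (n j : ℝ) ^ f j),
      tsum_eq_single default (fun n hn => absurd (Subsingleton.elim _ _) hn),
      Set.indicator_of_mem]
    · simp
    · exact ⟨fun i => i.elim0, fun i => i.elim0⟩
  | succ r ih =>
    rw [tsum_boundedTuples_succ N fun n => ENNReal.ofReal (∏ j, 1 / (n j : ℝ) ^ f j),
      List.ofFn_succ_last, harmonicSum_concat, ENNReal.ofReal_sum_of_nonneg]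
    · refine Finset.sum_congr rfl fun n _ => ?_
      simp only [Fin.prod_univ_castSucc, Fin.snoc_castSucc, Fin.snoc_last]
      rw [div_eq_mul_one_div (harmonicSum _ _), ENNReal.ofReal_mul (harmonicSum_nonneg _ _), ← ih,
        ← ENNReal.tsum_mul_right]
      congr 1 with m
      rw [ENNReal.ofReal_mul (Finset.prod_nonneg fun _ _ => by positivity)]
      simp
    · intro n _
      exact div_nonneg (harmonicSum_nonneg _ _) (by positivity)

theorem hasSum_of_tsum_ofReal {ι : Type*} {f : ι → ℝ} {a : ℝ} (hf : ∀ i, 0 ≤ f i) (ha : 0 ≤ a)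
    (h : ∑' i, ENNReal.ofReal (f i) = ENNReal.ofReal a) : HasSum f a := by
  have hs : Summable f := by
    have := ENNReal.summable_toReal (f := fun i => ENNReal.ofReal (f i)) (by simp [h])
    simpa [ENNReal.toReal_ofReal (hf _)] using this
  have : ∑' i, f i = a := by
    rw [← ENNReal.toReal_ofReal ha, ← h, ENNReal.tsum_toReal_eq (by simp)]
    simp [ENNReal.toReal_ofReal (hf _)]
  exact this ▸ hs.hasSum

/-- The length becomes a free variable, which makes `List.ofFn f` usable although its length is r
only propositionally. -/
theorem mzv_eq_tsum {k : List ℕ} {r : ℕ} (h : k.length = r) :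
    mzv k = ∑' n : increasingTuples r,
      ∏ j : Fin r, 1 / ((n : Fin r → ℕ) j : ℝ) ^ k.get (j.cast h.symm) := by
  subst h; rfl

theorem mzv_ofFn {r : ℕ} (f : Fin r → ℕ) :
    mzv (List.ofFn f) = ∑' n : increasingTuples r, ∏ j, 1 / ((n : Fin r → ℕ) j : ℝ) ^ f j := by
  rw [mzv_eq_tsum (List.length_ofFn (f := f))]
  simp

theorem tsum_increasingTuples_eq {r : ℕ} (f : Fin (r + 1) → ℕ) :
    ∑' n : increasingTuples (r + 1),
        ENNReal.ofReal (∏ j, 1 / ((n : Fin (r + 1) → ℕ) j : ℝ) ^ f j) =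
      ∑' n, ENNReal.ofReal (lastTerm (List.ofFn f) n) := by
  rw [tsum_increasingTuples_succ fun n => ENNReal.ofReal (∏ j, 1 / (n j : ℝ) ^ f j)]
  congr 1 with n
  simp only [Fin.prod_univ_castSucc, Fin.snoc_castSucc, Fin.snoc_last]
  rw [List.ofFn_succ_last, lastTerm_concat, div_eq_mul_one_div (harmonicSum _ _),
    ENNReal.ofReal_mul (harmonicSum_nonneg _ _), ← tsum_boundedTuples_eq_harmonicSum,
    ← ENNReal.tsum_mul_right]
  congr 1 with m
  rw [ENNReal.ofReal_mul (Finset.prod_nonneg fun _ _ => by positivity)]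
  simp

/-! ### Convergence -/

/-- Forget the ordering of the variables and lower every exponent to 1. -/
theorem harmonicSum_le (k : List ℕ) (hk : ∀ x ∈ k, 0 < x) (N : ℕ) :
    harmonicSum k N ≤ (harmonic N : ℝ) ^ k.length := by
  induction k using List.reverseRecOn generalizing N with
  | nil => simp
  | append_singleton k a ih =>
    have hk' : ∀ x ∈ k, 0 < x := fun x hx => hk x (by simp [hx])
    have ha : 0 < a := hk a (by simp)
    rw [harmonicSum_concat, List.length_append, List.length_singleton, pow_succ]
    have : (harmonic N : ℝ) = ∑ n ∈ Finset.range N, 1 / ((n : ℝ) + 1) := by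
      simp [harmonic]
    nth_rw 2 [this]
    rw [Finset.mul_sum]
    refine Finset.sum_le_sum fun n hn => ?_
    rw [Finset.mem_range] at hn
    rw [div_eq_mul_one_div]
    have hH : (harmonic n : ℝ) ≤ harmonic N := by
      have : harmonic n ≤ harmonic N :=
        Finset.sum_le_sum_of_subset_of_nonneg (Finset.range_mono hn.le)
          fun _ _ _ => by positivity
      exact_mod_cast this
    have h0 : (0 : ℝ) ≤ harmonic n := by
      have : 0 ≤ harmonic n := Finset.sum_nonneg fun _ _ => by positivity
      exact_mod_cast this
    refine mul_le_mul ((ih hk' n).trans (pow_le_pow_left₀ h0 hH _)) ?_ (by positivity)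
      (pow_nonneg (h0.trans hH) _)
    refine one_div_le_one_div_of_le (by positivity) (le_self_pow₀ ?_ ha.ne')
    linarith [n.cast_nonneg (α := ℝ)]

/-- Powers of harmonic numbers grow more slowly than n ^ (1 / 2), so the terms are O(n ^ (-3 / 2)).
-/
theorem summable_lastTerm {w c : ℕ} (hc : 2 ≤ c) {k : List ℕ} (hk : k ∈ almostAdmissible w c) :
    Summable (lastTerm k) := by
  obtain ⟨l, a, rfl, hl, hca, -⟩ := hk
  set p := l.length
  -- Chosen so that p ε ≤ 1 / 2, with p + 1 in place of p to allow p = 0.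
  set ε : ℝ := 1 / (2 * (p + 1)) with hε
  have hε0 : 0 < ε := by positivity
  have hsum : Summable fun n : ℕ => (1 + 1 / ε) ^ p * ((n + 1 : ℕ) : ℝ) ^ (-3 / 2 : ℝ) :=
    ((summable_nat_add_iff 1).2 (Real.summable_nat_rpow.2 (by norm_num))).mul_left _
  refine Summable.of_nonneg_of_le (lastTerm_nonneg _) (fun n => ?_) hsum
  rw [lastTerm_concat]
  have hn : (1 : ℝ) ≤ (n : ℝ) + 1 := by linarith [n.cast_nonneg (α := ℝ)]
  have hn0 : (0 : ℝ) < (n : ℝ) + 1 := by linarith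
  have h1 : (harmonic n : ℝ) ≤ (1 + 1 / ε) * ((n : ℝ) + 1) ^ ε := by
    have h2 : Real.log n ≤ ((n : ℝ) + 1) ^ ε / ε := by
      rcases Nat.eq_zero_or_pos n with rfl | h
      · simp; positivity
      · exact (Real.log_le_log (by exact_mod_cast h) (by linarith)).trans
          (Real.log_le_rpow_div hn0.le hε0)
    have h3 := harmonic_le_one_add_log n
    have h4 := Real.one_le_rpow hn hε0.le
    calc (harmonic n : ℝ) ≤ 1 + Real.log n := h3
      _ ≤ ((n : ℝ) + 1) ^ ε + ((n : ℝ) + 1) ^ ε / ε := add_le_add h4 h2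
      _ = _ := by ring
  have h0 : (0 : ℝ) ≤ harmonic n := by
    have : 0 ≤ harmonic n := Finset.sum_nonneg fun _ _ => by positivity
    exact_mod_cast this
  have h5 : harmonicSum l n ≤ (1 + 1 / ε) ^ p * ((n : ℝ) + 1) ^ (1 / 2 : ℝ) := by
    refine (harmonicSum_le l hl n).trans ((pow_le_pow_left₀ h0 h1 _).trans ?_)
    rw [mul_pow]
    refine mul_le_mul_of_nonneg_left ?_ (by positivity)
    rw [← Real.rpow_natCast, ← Real.rpow_mul hn0.le]
    refine Real.rpow_le_rpow_of_exponent_le hn ?_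
    rw [hε]
    field_simp
    linarith
  have h6 : (((n : ℝ) + 1) ^ a)⁻¹ ≤ ((n : ℝ) + 1) ^ (-2 : ℝ) := by
    rw [Real.rpow_neg hn0.le]
    refine inv_anti₀ (by positivity) ?_
    rw [← Real.rpow_natCast]
    exact Real.rpow_le_rpow_of_exponent_le hn (by exact_mod_cast hc.trans hca)
  rw [div_eq_mul_inv]
  refine (mul_le_mul h5 h6 (by positivity) (by positivity)).trans (le_of_eq ?_)
  rw [mul_assoc, ← Real.rpow_add hn0]
  norm_num

/-- The series of `mzv` grouped by its largest variable n + 1. -/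
theorem hasSum_lastTerm {w c : ℕ} (hc : 2 ≤ c) {k : List ℕ} (hk : k ∈ almostAdmissible w c) :
    HasSum (lastTerm k) (mzv k) := by
  have hs := summable_lastTerm hc hk
  obtain ⟨l, a, rfl, -⟩ := hk
  have hl : (l ++ [a]) = List.ofFn (n := l.length + 1) (Fin.snoc l.get a) := by
    rw [List.ofFn_succ_last]
    simp
  rw [hl] at hs ⊢
  rw [mzv_ofFn]
  convert hs.hasSum using 1
  refine (hasSum_of_tsum_ofReal (fun n => Finset.prod_nonneg fun _ _ => by positivity)
    (tsum_nonneg (lastTerm_nonneg _)) ?_).tsum_eq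
  rw [tsum_increasingTuples_eq, ENNReal.ofReal_tsum_of_nonneg (lastTerm_nonneg _) hs]

theorem hasSum_lastTermLin {w c : ℕ} (hc : 2 ≤ c) {α : FormalSum}
    (hα : α ∈ Finsupp.supported ℚ ℚ (almostAdmissible w c)) :
    HasSum (fun n => lastTermLin n α) (zetaLin α) := by
  refine supported_induction (P := fun α => HasSum (fun n => lastTermLin n α) (zetaLin α)) hα
    ?_ ?_ ?_ ?_
  · simp [hasSum_zero]
  · intro a b ha hb
    simpa using ha.add hb
  · intro q a ha
    simpa [Rat.smul_def] using ha.mul_left (q : ℝ)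
  · intro k hk
    simp only [lastTermLin_ofIndex]
    simpa [zetaLin, ofIndex] using hasSum_lastTerm hc hk

theorem zetaLin_mem_zetaSpace {α : FormalSum} {w : ℕ} (h : IsAdmissibleOfWeight α w) :
    (zetaLin α : ℂ) ∈ zetaSpace w := by
  rw [zetaLin, Finsupp.linearCombination_apply, Finsupp.sum, Complex.ofReal_sum]
  refine sum_mem fun k hk => ?_
  have : ((α k • mzv k : ℝ) : ℂ) = α k • (mzv k : ℂ) := by
    simp [Rat.smul_def]
  rw [this]
  exact Submodule.smul_mem _ _ (Submodule.subset_span ⟨k, (h k hk).1, (h k hk).2, rfl⟩)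

/-! ### The multiple series -/

/-- The set of `p`-tuples of integers with `0 < a₁ ≤ ⋯ ≤ a_p ≤ N`. -/
def monotoneTuples (p N : ℕ) : Set (Fin p → ℕ) :=
  {a | Monotone a ∧ ∀ i, 0 < a i ∧ a i ≤ N}

theorem snoc_mem_monotoneTuples {p : ℕ} (a : Fin p → ℕ) (N M : ℕ) :
    (Fin.snoc a N : Fin (p + 1) → ℕ) ∈ monotoneTuples (p + 1) M ↔
      a ∈ monotoneTuples p N ∧ 0 < N ∧ N ≤ M := by
  simp only [monotoneTuples, Set.mem_ofPred_eq, monotone_snoc_iff,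
    forall_snoc_iff (fun x => 0 < x ∧ x ≤ M)]
  constructor
  · rintro ⟨⟨h1, h2⟩, h3, h4⟩
    exact ⟨⟨h1, fun j => ⟨(h3 j).1, h2 j⟩⟩, h4⟩
  · rintro ⟨⟨h1, h2⟩, h3⟩
    exact ⟨⟨h1, fun j => (h2 j).2⟩, fun j => ⟨(h2 j).1, (h2 j).2.trans h3.2⟩, h3⟩

theorem tsum_monotoneTuples_succ {p : ℕ} (M : ℕ) (f : (Fin (p + 1) → ℕ) → ℝ≥0∞) :
    ∑' a : monotoneTuples (p + 1) M, f a = ∑ N ∈ Finset.range M,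
      ∑' a : monotoneTuples p (N + 1), f (Fin.snoc (a : Fin p → ℕ) (N + 1)) := by
  rw [tsum_subtype, tsum_snoc, tsum_eq_zero_add' ENNReal.summable]
  have h0 : ∀ a : Fin p → ℕ, (Fin.snoc a 0 : Fin (p + 1) → ℕ) ∉ monotoneTuples (p + 1) M := by
    intro a
    simp [snoc_mem_monotoneTuples]
  simp only [Set.indicator_of_notMem (h0 _), tsum_zero, zero_add]
  rw [tsum_eq_sum (s := Finset.range M)]
  · refine Finset.sum_congr rfl fun N hN => ?_
    rw [tsum_subtype (monotoneTuples p (N + 1)) fun n => f (Fin.snoc n (N + 1))]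
    congr 1 with n
    have := Finset.mem_range.1 hN
    classical
    simp only [Set.indicator_apply, snoc_mem_monotoneTuples, Nat.succ_pos, Nat.succ_le_iff, this,
      and_true]
  · intro N hN
    rw [Finset.mem_range] at hN
    refine ENNReal.tsum_eq_zero.2 fun n => Set.indicator_of_notMem ?_ _
    rw [snoc_mem_monotoneTuples]; omega

theorem tsum_monotoneTuples_eq_harmonicStar (p N : ℕ) :
    ∑' a : monotoneTuples p N, ENNReal.ofReal (1 / ∏ j, ((a : Fin p → ℕ) j : ℝ)) =
      ENNReal.ofReal (harmonicStar p N) := by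
  induction p generalizing N with
  | zero =>
    rw [tsum_subtype (monotoneTuples 0 N) fun n => ENNReal.ofReal (1 / ∏ j, (n j : ℝ)),
      tsum_eq_single default (fun n hn => absurd (Subsingleton.elim _ _) hn),
      Set.indicator_of_mem]
    · simp [harmonicStar]
    · exact ⟨fun i => i.elim0, fun i => i.elim0⟩
  | succ p ih =>
    rw [tsum_monotoneTuples_succ N fun n => ENNReal.ofReal (1 / ∏ j, (n j : ℝ)), harmonicStar,
      ENNReal.ofReal_sum_of_nonneg]
    · refine Finset.sum_congr rfl fun n _ => ?_
      simp only [Fin.prod_univ_castSucc, Fin.snoc_castSucc, Fin.snoc_last]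
      rw [div_eq_mul_one_div (harmonicStar _ _), ENNReal.ofReal_mul (harmonicStar_nonneg _ _),
        ← ih, ← ENNReal.tsum_mul_right]
      congr 1 with m
      rw [← one_div_mul_one_div, ENNReal.ofReal_mul (by positivity)]
      simp
    · intro n _
      exact div_nonneg (harmonicStar_nonneg _ _) (by positivity)

/-- The summand of the series of the sum formula, as a function of the increasing tuple
`(m_r, …, m₁)`. -/
def starWeight (s p q : ℕ) (n : Fin (s + 1) → ℕ) : ℝ≥0∞ :=
  ENNReal.ofReal (∏ j, 1 / (n j : ℝ) ^ 2) *
    (ENNReal.ofReal (harmonicStar p (n (Fin.last s))) *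
      ENNReal.ofReal (harmonicStar q (n (Fin.last s))))

theorem tsum_starWeight (s p q : ℕ) :
    ∑' n : increasingTuples (s + 1), starWeight s p q n =
      ∑' n, ENNReal.ofReal (lastTerm (List.replicate (s + 1) 2) n * harmonicStar p (n + 1) *
        harmonicStar q (n + 1)) := by
  rw [tsum_increasingTuples_succ]
  congr 1 with n
  simp only [starWeight, Fin.snoc_last, ENNReal.tsum_mul_right]
  rw [mul_assoc, ENNReal.ofReal_mul (lastTerm_nonneg _ _),
    ENNReal.ofReal_mul (harmonicStar_nonneg _ _)]
  congr 1
  simp only [Fin.prod_univ_castSucc, Fin.snoc_castSucc, Fin.snoc_last]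
  rw [List.replicate_succ', lastTerm_concat, div_eq_mul_one_div (harmonicSum _ _),
    ENNReal.ofReal_mul (harmonicSum_nonneg _ _), ← List.ofFn_const,
    ← tsum_boundedTuples_eq_harmonicSum, ← ENNReal.tsum_mul_right]
  congr 1 with m
  rw [ENNReal.ofReal_mul (Finset.prod_nonneg fun _ _ => by positivity)]
  simp

/-- Reversal turns the decreasing m into an increasing n, so that m₁, which bounds both star tuples,
is the last entry of n. -/
theorem mem_seriesRange_iff {s p q : ℕ} (n : Fin (s + 1) → ℕ) (a : Fin p → ℕ) (b : Fin q → ℕ) :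
    (n ∘ Fin.rev, a, b) ∈ seriesRange (s + 1) p q ↔ n ∈ increasingTuples (s + 1) ∧
      a ∈ monotoneTuples p (n (Fin.last s)) ∧ b ∈ monotoneTuples q (n (Fin.last s)) := by
  have h0 : ∀ P : Fin (s + 1) → Prop, (∀ j : Fin (s + 1), (j : ℕ) = 0 → P j) ↔ P 0 := by
    intro P
    constructor
    · intro h; exact h 0 rfl
    · intro h j hj
      rwa [show j = 0 from Fin.ext hj]
  have h1 : StrictAnti (n ∘ Fin.rev) ↔ StrictMono n := by
    constructor
    · intro h
      have := h.comp Fin.rev_strictAnti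
      simpa [Function.comp_def] using this
    · intro h
      exact h.comp_strictAnti Fin.rev_strictAnti
  have h2 : (∀ j : Fin (s + 1), 0 < n (Fin.rev j)) ↔ ∀ j, 0 < n j :=
    Fin.rev_surjective.forall (p := fun j => 0 < n j) |>.symm
  simp only [seriesRange, Set.mem_ofPred_eq, h0, h1, h2, monotoneTuples, increasingTuples,
    Function.comp_apply, Fin.rev_zero]

theorem tsum_seriesTerm (s p q : ℕ) :
    ∑' x : seriesRange (s + 1) p q, ENNReal.ofReal (seriesTerm x.1) =
      ∑' n : increasingTuples (s + 1), starWeight s p q n := by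
  rw [tsum_subtype (seriesRange (s + 1) p q) fun x => ENNReal.ofReal (seriesTerm x),
    tsum_subtype, ENNReal.tsum_prod',
    ← (Equiv.arrowCongr (Fin.revPerm (n := s + 1)) (Equiv.refl ℕ)).tsum_eq]
  congr 1 with n
  have hn : (Equiv.arrowCongr (Fin.revPerm (n := s + 1)) (Equiv.refl ℕ)) n = n ∘ Fin.rev := rfl
  rw [hn, ENNReal.tsum_prod']
  by_cases h : n ∈ increasingTuples (s + 1)
  · rw [Set.indicator_of_mem h, starWeight, ← tsum_monotoneTuples_eq_harmonicStar,
      ← tsum_monotoneTuples_eq_harmonicStar,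
      tsum_subtype (monotoneTuples p (n (Fin.last s)))
        fun a => ENNReal.ofReal (1 / ∏ j, (a j : ℝ)),
      tsum_subtype (monotoneTuples q (n (Fin.last s)))
        fun a => ENNReal.ofReal (1 / ∏ j, (a j : ℝ)),
      ← ENNReal.tsum_mul_right, ← ENNReal.tsum_mul_left]
    congr 1 with a
    rw [← ENNReal.tsum_mul_left, ← ENNReal.tsum_mul_left]
    congr 1 with b
    by_cases ha : a ∈ monotoneTuples p (n (Fin.last s))
    · by_cases hb : b ∈ monotoneTuples q (n (Fin.last s))
      · rw [Set.indicator_of_mem ((mem_seriesRange_iff n a b).2 ⟨h, ha, hb⟩),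
          Set.indicator_of_mem ha, Set.indicator_of_mem hb,
          ← ENNReal.ofReal_mul (by positivity),
          ← ENNReal.ofReal_mul (Finset.prod_nonneg fun _ _ => by positivity)]
        congr 1
        have : ∏ j, ((n (Fin.rev j) : ℝ) ^ 2) = ∏ j, ((n j : ℝ) ^ 2) :=
          Equiv.prod_comp Fin.revPerm fun j => (n j : ℝ) ^ 2
        simp only [seriesTerm, Function.comp_apply, this]
        simp only [one_div, Finset.prod_inv_distrib, mul_inv, mul_assoc]
      · rw [Set.indicator_of_notMem hb, Set.indicator_of_notMem]
        · simp
        · rw [mem_seriesRange_iff]; tauto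
    · rw [Set.indicator_of_notMem ha, Set.indicator_of_notMem]
      · simp
      · rw [mem_seriesRange_iff]; tauto
  · rw [Set.indicator_of_notMem h]
    refine ENNReal.tsum_eq_zero.2 fun a => ENNReal.tsum_eq_zero.2 fun b =>
      Set.indicator_of_notMem ?_ _
    rw [mem_seriesRange_iff]; tauto

theorem mem_pairRange_iff {p q : ℕ} (a : Fin p → ℕ) (b : Fin q → ℕ) (M N : ℕ) :
    ((Fin.snoc a M, Fin.snoc b N) : (Fin (p + 1) → ℕ) × (Fin (q + 1) → ℕ)) ∈
      pairRange (p + 1) (q + 1) ↔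
      M = N ∧ 0 < N ∧ a ∈ monotoneTuples p N ∧ b ∈ monotoneTuples q N := by
  have h0 : ∀ (r : ℕ) (P : Fin (r + 1) → Prop),
      (∀ j : Fin (r + 1), (j : ℕ) + 1 = r + 1 → P j) ↔ P (Fin.last r) := by
    intro r P
    constructor
    · intro h; exact h _ rfl
    · intro h j hj
      rwa [show j = Fin.last r from Fin.ext (Nat.succ_injective hj)]
  have h1 : (∀ (i : Fin (p + 1)) (j : Fin (q + 1)), (i : ℕ) + 1 = p + 1 → (j : ℕ) + 1 = q + 1 →
      (Fin.snoc a M : Fin (p + 1) → ℕ) i = (Fin.snoc b N : Fin (q + 1) → ℕ) j) ↔ M = N := by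
    constructor
    · intro h
      simpa using h (Fin.last p) (Fin.last q) rfl rfl
    · rintro rfl i j hi hj
      rw [show i = Fin.last p from Fin.ext (Nat.succ_injective hi),
        show j = Fin.last q from Fin.ext (Nat.succ_injective hj)]
      simp
  simp only [pairRange, Set.mem_ofPred_eq, h1, monotone_snoc_iff, forall_snoc_iff (0 < ·),
    monotoneTuples, forall_and]
  constructor
  · rintro ⟨⟨⟨h1, h2⟩, h3, h4⟩, ⟨⟨h5, h6⟩, h7, h8⟩, rfl⟩
    tauto
  · rintro ⟨rfl, h2, h3, h4⟩
    tauto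

/-- The common value n + 1 of the two last entries contributes 1 / (n + 1) ^ 2; the remaining
entries form two independent star sums bounded by n + 1. -/
theorem tsum_pairRange (p q : ℕ) :
    ∑' x : pairRange (p + 1) (q + 1),
        ENNReal.ofReal (1 / ((∏ i, (x.1.1 i : ℝ)) * ∏ j, (x.1.2 j : ℝ))) =
      ∑' n, ENNReal.ofReal (lastTerm [2] n * harmonicStar p (n + 1) * harmonicStar q (n + 1)) := by
  rw [tsum_subtype (pairRange (p + 1) (q + 1)) fun x =>
      ENNReal.ofReal (1 / ((∏ i, (x.1 i : ℝ)) * ∏ j, (x.2 j : ℝ))), ENNReal.tsum_prod', tsum_snoc,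
    tsum_eq_zero_add' ENNReal.summable]
  have h0 : ∀ (a : Fin p → ℕ) (b : Fin (q + 1) → ℕ),
      ((Fin.snoc a 0, b) : (Fin (p + 1) → ℕ) × (Fin (q + 1) → ℕ)) ∉
        pairRange (p + 1) (q + 1) := by
    intro a b h
    simpa using h.1.2 (Fin.last p)
  simp only [Set.indicator_of_notMem (h0 _ _), tsum_zero, zero_add]
  congr 1 with n
  have h1 : lastTerm [2] n = 1 / ((n : ℝ) + 1) ^ 2 := by simp [lastTerm]
  rw [mul_assoc, ENNReal.ofReal_mul (lastTerm_nonneg _ _),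
    ENNReal.ofReal_mul (harmonicStar_nonneg _ _), ← tsum_monotoneTuples_eq_harmonicStar,
    ← tsum_monotoneTuples_eq_harmonicStar,
    tsum_subtype (monotoneTuples p (n + 1)) fun a => ENNReal.ofReal (1 / ∏ j, (a j : ℝ)),
    tsum_subtype (monotoneTuples q (n + 1)) fun a => ENNReal.ofReal (1 / ∏ j, (a j : ℝ)),
    ← ENNReal.tsum_mul_right, ← ENNReal.tsum_mul_left]
  congr 1 with a
  rw [tsum_snoc, tsum_eq_single (n + 1), ← ENNReal.tsum_mul_left, ← ENNReal.tsum_mul_left]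
  · congr 1 with b
    by_cases ha : a ∈ monotoneTuples p (n + 1)
    · by_cases hb : b ∈ monotoneTuples q (n + 1)
      · rw [Set.indicator_of_mem ((mem_pairRange_iff a b _ _).2 ⟨rfl, n.succ_pos, ha, hb⟩),
          Set.indicator_of_mem ha, Set.indicator_of_mem hb, h1,
          ← ENNReal.ofReal_mul (by positivity), ← ENNReal.ofReal_mul (by positivity)]
        congr 1
        simp only [Fin.prod_univ_castSucc, Fin.snoc_castSucc, Fin.snoc_last]
        push_cast
        simp only [one_div, mul_inv, pow_two]
        ring
      · rw [Set.indicator_of_notMem hb, Set.indicator_of_notMem]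
        · simp
        · rw [mem_pairRange_iff]; tauto
    · rw [Set.indicator_of_notMem ha, Set.indicator_of_notMem]
      · simp
      · rw [mem_pairRange_iff]; tauto
  · intro N hN
    refine ENNReal.tsum_eq_zero.2 fun b => Set.indicator_of_notMem ?_ _
    rw [mem_pairRange_iff]
    rintro ⟨rfl, -⟩
    exact hN rfl

/-! ### Zeta values of the formal sums as multiple series -/

theorem zetaLin_nonneg {w c : ℕ} (hc : 2 ≤ c) {α : FormalSum}
    (hα : α ∈ Finsupp.supported ℚ ℚ (almostAdmissible w c)) (h : ∀ n, 0 ≤ lastTermLin n α) :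
    0 ≤ zetaLin α :=
  (hasSum_lastTermLin hc hα).nonneg h

theorem tsum_ofReal_lastTermLin {w c : ℕ} (hc : 2 ≤ c) {α : FormalSum}
    (hα : α ∈ Finsupp.supported ℚ ℚ (almostAdmissible w c)) (h : ∀ n, 0 ≤ lastTermLin n α) :
    ∑' n, ENNReal.ofReal (lastTermLin n α) = ENNReal.ofReal (zetaLin α) := by
  have := hasSum_lastTermLin hc hα
  rw [← ENNReal.ofReal_tsum_of_nonneg h this.summable, this.tsum_eq]

theorem lastTermLin_sumFormulaIndex_nonneg (k l r n : ℕ) :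
    0 ≤ lastTermLin n (sumFormulaIndex k l r) := by
  rw [lastTermLin_sumFormulaIndex]
  exact mul_nonneg (mul_nonneg (lastTerm_nonneg _ _) (harmonicStar_nonneg _ _))
    (harmonicStar_nonneg _ _)

theorem tsum_starWeight_eq_zetaLin {k l s : ℕ} (hk : s + 1 ≤ k) (hl : s + 1 ≤ l) :
    ∑' n : increasingTuples (s + 1), starWeight s (k - (s + 1)) (l - (s + 1)) n =
      ENNReal.ofReal (zetaLin (sumFormulaIndex k l (s + 1))) := by
  rw [tsum_starWeight, ← tsum_ofReal_lastTermLin le_rfl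
    (sumFormulaIndex_mem_supported k l (s + 1) s.succ_pos hk hl)
    (lastTermLin_sumFormulaIndex_nonneg k l (s + 1))]
  simp only [lastTermLin_sumFormulaIndex]

theorem zetaLin_sumFormulaIndex_nonneg {k l s : ℕ} (hk : s + 1 ≤ k) (hl : s + 1 ≤ l) :
    0 ≤ zetaLin (sumFormulaIndex k l (s + 1)) :=
  zetaLin_nonneg le_rfl (sumFormulaIndex_mem_supported k l (s + 1) s.succ_pos hk hl)
    (lastTermLin_sumFormulaIndex_nonneg k l (s + 1))

theorem hasSum_seriesTerm {k l s : ℕ} (hk : s + 1 ≤ k) (hl : s + 1 ≤ l) :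
    HasSum (fun x : seriesRange (s + 1) (k - (s + 1)) (l - (s + 1)) => seriesTerm x.1)
      (zetaLin (sumFormulaIndex k l (s + 1))) := by
  refine hasSum_of_tsum_ofReal (fun x => ?_) (zetaLin_sumFormulaIndex_nonneg hk hl) ?_
  · unfold seriesTerm; positivity
  · rw [tsum_seriesTerm, tsum_starWeight_eq_zetaLin hk hl]

theorem zetaLin_sumFormulaIndex_pos {k l s : ℕ} (hk : s + 1 ≤ k) (hl : s + 1 ≤ l) :
    0 < zetaLin (sumFormulaIndex k l (s + 1)) := by
  have h := hasSum_seriesTerm hk hl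
  have h0 : ∀ x : seriesRange (s + 1) (k - (s + 1)) (l - (s + 1)), 0 ≤ seriesTerm x.1 := fun x => by
    unfold seriesTerm; positivity
  -- The term with m = (r, …, 1) and all a_i = b_i = 1 is positive, which suffices because no term
  -- is negative.
  let n : Fin (s + 1) → ℕ := fun j => j + 1
  have hx : (n ∘ Fin.rev, (fun _ => 1), (fun _ => 1)) ∈
      seriesRange (s + 1) (k - (s + 1)) (l - (s + 1)) := by
    rw [mem_seriesRange_iff]
    refine ⟨⟨fun i j hij => Nat.succ_lt_succ hij, fun j => Nat.succ_pos _⟩,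
      ⟨fun _ _ _ => le_rfl, fun i => ?_⟩, fun _ _ _ => le_rfl, fun i => ?_⟩ <;> simp [n]
  rw [← h.tsum_eq]
  refine h.summable.tsum_pos h0 ⟨_, hx⟩ ?_
  simp only [seriesTerm, Function.comp_apply, n]
  positivity

theorem lastTermLin_circ_starSum_nonneg (k l n : ℕ) :
    0 ≤ lastTermLin n
      (circ (starSum (List.replicate (k + 1) 1)) (starSum (List.replicate (l + 1) 1))) := by
  rw [lastTermLin_circ_starSum]
  exact mul_nonneg (mul_nonneg (lastTerm_nonneg _ _) (harmonicStar_nonneg _ _))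
    (harmonicStar_nonneg _ _)

theorem hasSum_pairRange (k l : ℕ) :
    HasSum (fun x : pairRange (k + 1) (l + 1) =>
        1 / ((∏ i, (x.1.1 i : ℝ)) * ∏ j, (x.1.2 j : ℝ)))
      (zetaLin (circ (starSum (List.replicate (k + 1) 1))
        (starSum (List.replicate (l + 1) 1)))) := by
  have hs := circ_starSum_mem_supported (k + 1) (l + 1) k.succ_pos l.succ_pos
  refine hasSum_of_tsum_ofReal (fun x => by positivity)
    (zetaLin_nonneg le_rfl hs (lastTermLin_circ_starSum_nonneg k l)) ?_
  rw [tsum_pairRange, ← tsum_ofReal_lastTermLin le_rfl hs (lastTermLin_circ_starSum_nonneg k l)]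
  simp only [lastTermLin_circ_starSum]

/-- Linear combinations with the same sums over each last variable have the same zeta value. -/
theorem zetaLin_congr {w v : ℕ} {α β : FormalSum}
    (hα : α ∈ Finsupp.supported ℚ ℚ (almostAdmissible w 2))
    (hβ : β ∈ Finsupp.supported ℚ ℚ (almostAdmissible v 2))
    (h : ∀ n, lastTermLin n α = lastTermLin n β) : zetaLin α = zetaLin β := by
  have h1 := hasSum_lastTermLin le_rfl hα
  simp only [h] at h1
  exact h1.unique (hasSum_lastTermLin le_rfl hβ)

/-- The formal sums themselves are not compared. In one product the square of n + 1 comes from the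
entry 2, in the other from the two final ones. -/
theorem zetaLin_sumFormulaIndex_one (k l : ℕ) :
    zetaLin (sumFormulaIndex (k + 1) (l + 1) 1) = zetaLin (circ
      (starSum (List.replicate (k + 1) 1)) (starSum (List.replicate (l + 1) 1))) :=
  zetaLin_congr (sumFormulaIndex_mem_supported _ _ 1 one_pos (by omega) (by omega))
    (circ_starSum_mem_supported _ _ k.succ_pos l.succ_pos) fun n => by
      rw [lastTermLin_sumFormulaIndex, lastTermLin_circ_starSum]
      simp

theorem zetaLin_sumFormulaIndex_self (r : ℕ) (hr : 0 < r) :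
    zetaLin (sumFormulaIndex r r r) = mzv (List.replicate r 2) := by
  have := zetaLin_congr (sumFormulaIndex_mem_supported r r r hr le_rfl le_rfl)
    (replicate_two_mem_supported r hr) fun n => by
      rw [lastTermLin_sumFormulaIndex]
      simp [harmonicStar]
  rw [this]
  simp [zetaLin, ofIndex]

open scoped Nat Topology
open MeasureTheory Set Filter

/-! ### One-dimensional integrals -/

/-- The function `e ^ (-u) (1 - e ^ (-u)) ^ m`. -/
def expWeight (m : ℕ) (u : ℝ) : ℝ := Real.exp (-u) * (1 - Real.exp (-u)) ^ m

@[fun_prop]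
theorem continuous_expWeight (m : ℕ) : Continuous (expWeight m) := by
  unfold expWeight; fun_prop

theorem one_sub_exp_neg_nonneg {u : ℝ} (hu : 0 ≤ u) : 0 ≤ 1 - Real.exp (-u) := by
  rw [sub_nonneg, Real.exp_le_one_iff]; linarith

theorem expWeight_nonneg (m : ℕ) {u : ℝ} (hu : 0 ≤ u) : 0 ≤ expWeight m u :=
  mul_nonneg (Real.exp_pos _).le (pow_nonneg (one_sub_exp_neg_nonneg hu) _)

theorem expWeight_le (m : ℕ) {u : ℝ} (hu : 0 ≤ u) : expWeight m u ≤ Real.exp (-u) :=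
  mul_le_of_le_one_right (Real.exp_pos _).le
    (pow_le_one₀ (one_sub_exp_neg_nonneg hu) (by linarith [Real.exp_pos (-u)]))

theorem hasDerivAt_one_sub_exp_neg_pow (n : ℕ) (u : ℝ) :
    HasDerivAt (fun u => (1 - Real.exp (-u)) ^ (n + 1)) ((n + 1) * expWeight n u) u := by
  have h : HasDerivAt (fun u => 1 - Real.exp (-u)) (Real.exp (-u)) u := by
    simpa using ((hasDerivAt_neg u).exp).const_sub 1
  refine (h.fun_pow (n + 1)).congr_deriv ?_
  simp [expWeight]; ring

theorem lintegral_expWeight_Ioc (n : ℕ) {u : ℝ} (hu : 0 ≤ u) :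
    ∫⁻ y in Ioc 0 u, ENNReal.ofReal (expWeight n y) =
      ENNReal.ofReal ((1 - Real.exp (-u)) ^ (n + 1) / (n + 1)) := by
  rw [← ofReal_integral_eq_lintegral_ofReal, ← intervalIntegral.integral_of_le hu]
  · congr 1
    rw [intervalIntegral.integral_eq_sub_of_hasDerivAt
      (f := fun u => (1 - Real.exp (-u)) ^ (n + 1) / (n + 1))]
    · simp
    · intro x _
      refine ((hasDerivAt_one_sub_exp_neg_pow n x).div_const ((n : ℝ) + 1)).congr_deriv ?_
      field_simp
    · exact (continuous_expWeight n).intervalIntegrable _ _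
  · exact (continuous_expWeight n).continuousOn.integrableOn_Icc.mono_set Ioc_subset_Icc_self
  · filter_upwards [ae_restrict_mem measurableSet_Ioc] with y hy
    exact expWeight_nonneg n hy.1.le

theorem integrableOn_pow_mul_exp_neg (p : ℕ) :
    IntegrableOn (fun u : ℝ => u ^ p * Real.exp (-u)) (Ioi 0) := by
  have := Real.GammaIntegral_convergent (s := p + 1) (by positivity)
  refine this.congr_fun (fun u hu => ?_) measurableSet_Ioi
  simp [mul_comm]

theorem integral_pow_mul_exp_neg (p : ℕ) :
    ∫ u in Ioi (0 : ℝ), u ^ p * Real.exp (-u) = p ! := by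
  rw [← Real.Gamma_nat_eq_factorial, Real.Gamma_eq_integral (by positivity)]
  refine setIntegral_congr_fun measurableSet_Ioi fun u hu => ?_
  simp [mul_comm]

theorem integrableOn_pow_mul_expWeight (p n : ℕ) :
    IntegrableOn (fun u : ℝ => u ^ p / p ! * expWeight n u) (Ioi 0) := by
  refine Integrable.mono' (integrableOn_pow_mul_exp_neg p)
    (Continuous.aestronglyMeasurable (by fun_prop)) ?_
  filter_upwards [ae_restrict_mem measurableSet_Ioi] with u hu
  rw [mem_Ioi] at hu
  rw [Real.norm_of_nonneg (mul_nonneg (by positivity) (expWeight_nonneg n hu.le))]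
  refine mul_le_mul (div_le_self (by positivity) ?_) (expWeight_le n hu.le)
    (expWeight_nonneg n hu.le) (by positivity)
  exact_mod_cast p.factorial_pos

theorem tendsto_pow_mul_expWeight (p n : ℕ) :
    Tendsto (fun u : ℝ => u ^ p / p ! * expWeight n u) atTop (𝓝 0) := by
  refine squeeze_zero' (g := fun u : ℝ => u ^ p * Real.exp (-u)) ?_ ?_
    (Real.tendsto_pow_mul_exp_neg_atTop_nhds_zero p)
  · filter_upwards [eventually_ge_atTop 0] with u hu
    exact mul_nonneg (by positivity) (expWeight_nonneg n hu)
  · filter_upwards [eventually_ge_atTop 0] with u hu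
    refine mul_le_mul (div_le_self (by positivity) ?_) (expWeight_le n hu)
      (expWeight_nonneg n hu) (by positivity)
    exact_mod_cast p.factorial_pos

/-- Integration by parts for the integrals of `u ^ p / p! * expWeight n u`. -/
theorem integral_pow_mul_expWeight_succ (p n : ℕ) :
    ∫ u in Ioi (0 : ℝ), u ^ p / p ! * expWeight (n + 1) u =
      (n + 2) * (∫ u in Ioi (0 : ℝ), u ^ (p + 1) / (p + 1)! * expWeight (n + 1) u) -
        (n + 1) * ∫ u in Ioi (0 : ℝ), u ^ (p + 1) / (p + 1)! * expWeight n u := by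
  -- Writing e ^ (-u) = 1 - (1 - e ^ (-u)) in the derivative of `expWeight (n + 1)` gives (n + 1)
  -- `expWeight n` - (n + 2) `expWeight (n + 1)`. The boundary terms vanish at 0 and at infinity.
  have hd : ∀ u ∈ Ici (0 : ℝ),
      HasDerivAt (fun u : ℝ => u ^ (p + 1) / (p + 1)! * expWeight (n + 1) u)
        (u ^ p / p ! * expWeight (n + 1) u -
          ((n + 2) * (u ^ (p + 1) / (p + 1)! * expWeight (n + 1) u) -
            (n + 1) * (u ^ (p + 1) / (p + 1)! * expWeight n u))) u := by
    intro u _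
    have h1 : HasDerivAt (fun u : ℝ => Real.exp (-u)) (-Real.exp (-u)) u := by
      simpa using (hasDerivAt_neg u).exp
    refine (((hasDerivAt_pow (p + 1) u).div_const ((p + 1)! : ℝ)).mul
      (h1.mul (hasDerivAt_one_sub_exp_neg_pow n u))).congr_deriv ?_
    have hp : ((p ! : ℕ) : ℝ) ≠ 0 := by exact_mod_cast p.factorial_ne_zero
    simp only [expWeight, Nat.factorial_succ, Pi.mul_apply]
    push_cast
    field_simp
    ring
  have i1 := integrableOn_pow_mul_expWeight p (n + 1)
  have i2 := (integrableOn_pow_mul_expWeight (p + 1) (n + 1)).const_mul ((n : ℝ) + 2)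
  have i3 := (integrableOn_pow_mul_expWeight (p + 1) n).const_mul ((n : ℝ) + 1)
  have key := integral_Ioi_of_hasDerivAt_of_tendsto' hd (i1.sub (i2.sub i3))
    (tendsto_pow_mul_expWeight (p + 1) (n + 1))
  have i4 := integral_sub i1 (i2.sub i3)
  simp only [Pi.sub_apply] at i4
  rw [i4, integral_sub i2 i3, integral_const_mul, integral_const_mul]
    at key
  simp at key
  linarith

theorem harmonicStar_succ_succ (p N : ℕ) :
    harmonicStar (p + 1) (N + 1) =
      harmonicStar (p + 1) N + harmonicStar p (N + 1) / ((N : ℝ) + 1) := by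
  simp only [harmonicStar, Finset.sum_range_succ]

theorem integral_expWeight (n : ℕ) :
    ∫ u in Ioi (0 : ℝ), expWeight n u = 1 / ((n : ℝ) + 1) := by
  have h : Tendsto (fun u => (1 - Real.exp (-u)) ^ (n + 1) / ((n : ℝ) + 1)) atTop
      (𝓝 ((1 - 0) ^ (n + 1) / ((n : ℝ) + 1))) :=
    ((Real.tendsto_exp_neg_atTop_nhds_zero.const_sub 1).pow _).div_const _
  have hi : IntegrableOn (expWeight n) (Ioi 0) := by
    simpa using integrableOn_pow_mul_expWeight 0 n
  rw [integral_Ioi_of_hasDerivAt_of_tendsto' (fun x _ => ?_) hi h]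
  · simp
  · refine ((hasDerivAt_one_sub_exp_neg_pow n x).div_const ((n : ℝ) + 1)).congr_deriv ?_
    field_simp

/-- After multiplication by n + 1, integration by parts becomes the recursion
`harmonicStar_succ_succ`. The case n = 0 is a Gamma integral. -/
theorem integral_pow_mul_expWeight (p n : ℕ) :
    ∫ u in Ioi (0 : ℝ), u ^ p / p ! * expWeight n u =
      harmonicStar p (n + 1) / ((n : ℝ) + 1) := by
  induction p generalizing n with
  | zero => simpa [harmonicStar] using integral_expWeight n
  | succ p ihp =>
    induction n with
    | zero =>
      have h1 : ∀ p, harmonicStar p 1 = 1 := by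
        intro p
        induction p with
        | zero => rfl
        | succ p ih => simp [harmonicStar, ih]
      have hp : (((p + 1)! : ℕ) : ℝ) ≠ 0 := by exact_mod_cast (p + 1).factorial_ne_zero
      have : ∀ u : ℝ, u ^ (p + 1) / (p + 1)! * expWeight 0 u =
          (((p + 1)! : ℕ) : ℝ)⁻¹ * (u ^ (p + 1) * Real.exp (-u)) := by
        intro u; simp [expWeight]; ring
      simp_rw [this]
      rw [integral_const_mul, integral_pow_mul_exp_neg]
      simp [h1, hp]
    | succ n ihn =>
      have h := integral_pow_mul_expWeight_succ p n
      rw [ihp, ihn] at h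
      have h2 := harmonicStar_succ_succ p (n + 1)
      push_cast at h h2 ⊢
      rw [eq_div_iff (by positivity), h2]
      field_simp at h ⊢
      linarith

theorem lintegral_pow_mul_expWeight (p n : ℕ) :
    ∫⁻ u in Ioi (0 : ℝ), ENNReal.ofReal (u ^ p / p !) * ENNReal.ofReal (expWeight n u) =
      ENNReal.ofReal (harmonicStar p (n + 1) / ((n : ℝ) + 1)) := by
  rw [← integral_pow_mul_expWeight,
    ofReal_integral_eq_lintegral_ofReal (integrableOn_pow_mul_expWeight p n)]
  · refine setLIntegral_congr_fun measurableSet_Ioi fun u hu => ?_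
    rw [mem_Ioi] at hu
    rw [ENNReal.ofReal_mul (by positivity)]
  · filter_upwards [ae_restrict_mem measurableSet_Ioi] with u hu
    rw [mem_Ioi] at hu
    exact mul_nonneg (by positivity) (expWeight_nonneg n hu.le)

/-! ### Tuples of gaps -/

/-- The value before `n j`, where `n₀ = 0`. -/
def prevValue {r : ℕ} (n : Fin r → ℕ) (j : Fin r) : ℕ :=
  if (j : ℕ) = 0 then 0 else n ⟨(j : ℕ) - 1, by omega⟩

theorem sum_Iic_eq_prevValue_add {r : ℕ} (f : Fin r → ℕ) (j : Fin r) :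
    ∑ i ∈ Finset.Iic j, f i = prevValue (fun j => ∑ i ∈ Finset.Iic j, f i) j + f j := by
  unfold prevValue
  split_ifs with h
  · have : Finset.Iic j = {j} := by
      ext i; simp only [Finset.mem_Iic, Finset.mem_singleton, Fin.le_def, Fin.ext_iff]; omega
    simp [this]
  · have : Finset.Iic j = insert j (Finset.Iic (⟨(j : ℕ) - 1, by omega⟩ : Fin r)) := by
      ext i; simp only [Finset.mem_Iic, Finset.mem_insert, Fin.le_def, Fin.ext_iff]; omega
    rw [this, Finset.sum_insert, add_comm]
    simp only [Finset.mem_Iic, Fin.le_def]; omega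

theorem prevValue_lt {r : ℕ} {n : Fin r → ℕ} (hn : n ∈ increasingTuples r) (j : Fin r) :
    prevValue n j < n j := by
  unfold prevValue
  split_ifs with h
  · exact hn.2 j
  · exact hn.1 (Fin.lt_def.2 (by simp; omega))

theorem sum_Iic_gap {r : ℕ} {n : Fin r → ℕ} (hn : n ∈ increasingTuples r) (j : Fin r) :
    ∑ i ∈ Finset.Iic j, (n i - prevValue n i) = n j := by
  obtain ⟨j, hj⟩ := j
  induction j with
  | zero =>
    rw [sum_Iic_eq_prevValue_add]
    simp [prevValue]
  | succ j ih =>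
    rw [sum_Iic_eq_prevValue_add]
    have h1 := prevValue_lt hn ⟨j + 1, hj⟩
    have h2 := ih (by omega)
    simp only [prevValue, Nat.succ_ne_zero, if_false, Nat.add_sub_cancel] at h1 h2 ⊢
    omega

/-- The increasing tuples correspond to the tuples of gaps, decreased by one. -/
def gapEquiv (r : ℕ) : (Fin r → ℕ) ≃ increasingTuples r where
  toFun m := ⟨fun j => ∑ i ∈ Finset.Iic j, (m i + 1), by
    refine ⟨fun i j hij => ?_, fun j => ?_⟩
    · refine Finset.sum_lt_sum_of_subset (i := j) (Finset.Iic_subset_Iic.2 hij.le) (by simp)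
        (by simpa using hij) (by simp) (by simp)
    · exact Finset.sum_pos (by simp) ⟨j, by simp⟩⟩
  invFun n j := n.1 j - prevValue n.1 j - 1
  left_inv m := by
    funext j
    dsimp only
    rw [sum_Iic_eq_prevValue_add]
    omega
  right_inv n := by
    ext j
    dsimp only
    rw [← sum_Iic_gap n.2 j]
    refine Finset.sum_congr rfl fun i _ => ?_
    have := prevValue_lt n.2 i
    omega

theorem gapEquiv_apply {r : ℕ} (m : Fin r → ℕ) (j : Fin r) :
    (gapEquiv r m : Fin r → ℕ) j = ∑ i ∈ Finset.Iic j, (m i + 1) := rfl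

theorem gapEquiv_sub_prevValue {r : ℕ} (m : Fin r → ℕ) (j : Fin r) :
    (gapEquiv r m : Fin r → ℕ) j - prevValue (gapEquiv r m : Fin r → ℕ) j = m j + 1 := by
  have := sum_Iic_eq_prevValue_add (fun i => m i + 1) j
  have h : (gapEquiv r m : Fin r → ℕ) = fun j => ∑ i ∈ Finset.Iic j, (m i + 1) := rfl
  rw [h]
  dsimp only
  omega

/-! ### Integrals over the orthant -/

/-- Lebesgue measure on `(0, ∞) ^ r`. -/
abbrev orthantMeasure (r : ℕ) : Measure (Fin r → ℝ) :=
  Measure.pi fun _ => (volume : Measure ℝ).restrict (Ioi 0)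

theorem posOrthant_eq_pi (r : ℕ) : posOrthant r = Set.univ.pi fun _ => Ioi 0 := by
  ext t; simp [posOrthant]

theorem restrict_posOrthant (r : ℕ) :
    (volume : Measure (Fin r → ℝ)).restrict (posOrthant r) = orthantMeasure r := by
  rw [posOrthant_eq_pi, volume_pi, Measure.restrict_pi_pi]

theorem measurableSet_posOrthant (r : ℕ) : MeasurableSet (posOrthant r) := by
  rw [posOrthant_eq_pi]
  exact MeasurableSet.univ_pi fun _ => measurableSet_Ioi

theorem ae_mem_posOrthant (r : ℕ) : ∀ᵐ t ∂orthantMeasure r, t ∈ posOrthant r := by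
  rw [← restrict_posOrthant]
  exact ae_restrict_mem (measurableSet_posOrthant r)

/-- The sum `x_j + ⋯ + x_r`. -/
def tailSum {r : ℕ} (x : Fin r → ℝ) (j : Fin r) : ℝ := ∑ i ∈ Finset.Ici j, x i

@[fun_prop]
theorem continuous_tailSum {r : ℕ} (j : Fin r) : Continuous fun x : Fin r → ℝ => tailSum x j := by
  unfold tailSum; fun_prop

theorem tailSum_zero {r : ℕ} (x : Fin (r + 1) → ℝ) : tailSum x 0 = ∑ i, x i := by
  unfold tailSum
  congr 1
  ext i; simp

theorem tailSum_cons_succ {r : ℕ} (a : ℝ) (x : Fin r → ℝ) (j : Fin r) :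
    tailSum (Fin.cons a x : Fin (r + 1) → ℝ) j.succ = tailSum x j := by
  simp [tailSum, ← Fin.map_succEmb_Ici]

theorem tailSum_pos {r : ℕ} {x : Fin r → ℝ} (hx : x ∈ posOrthant r) (j : Fin r) :
    0 < tailSum x j :=
  Finset.sum_pos (fun i _ => hx i) ⟨j, by simp⟩

/-- The first variable goes innermost because it occurs in the first tail sum only. -/
theorem lintegral_orthantMeasure_succ {r : ℕ} {f : (Fin (r + 1) → ℝ) → ℝ≥0∞}
    (hf : Measurable f) :
    ∫⁻ x, f x ∂orthantMeasure (r + 1) =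
      ∫⁻ x, (∫⁻ a in Ioi 0, f (Fin.cons a x)) ∂orthantMeasure r := by
  have h := (measurePreserving_piFinSuccAbove
    (fun _ : Fin (r + 1) => (volume : Measure ℝ).restrict (Ioi 0)) 0).symm
  have hg : Measurable fun z : ℝ × (Fin r → ℝ) => f (Fin.cons z.1 z.2) := by
    refine hf.comp ?_
    rw [measurable_pi_iff]
    intro j
    refine Fin.cases ?_ (fun j => ?_) j
    · simpa using measurable_fst
    · simpa [Function.comp_def] using (measurable_pi_apply j).comp measurable_snd
  rw [← lintegral_prod_symm' _ hg, ← h.lintegral_comp hf]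
  refine lintegral_congr fun z => ?_
  congr 1
  funext j
  refine Fin.cases ?_ (fun j => ?_) j <;> rfl

theorem lintegral_orthantMeasure_zero (f : (Fin 0 → ℝ) → ℝ≥0∞) :
    ∫⁻ x, f x ∂orthantMeasure 0 = f default := by
  rw [orthantMeasure, Measure.pi_of_empty _ default, lintegral_dirac]

theorem lintegral_Ioi_add_right (f : ℝ → ℝ≥0∞) (y : ℝ) :
    ∫⁻ a in Ioi 0, f (a + y) = ∫⁻ u in Ioi y, f u := by
  have := (measurePreserving_add_right (volume : Measure ℝ) y).setLIntegral_comp_preimage_emb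
    (MeasurableEquiv.addRight y).measurableEmbedding f (Ioi y)
  simpa using this

/-- The sum `(m_j + 1) + ⋯ + (m_r + 1)`. -/
def tailGaps {r : ℕ} (m : Fin r → ℕ) (j : Fin r) : ℕ := ∑ i ∈ Finset.Ici j, (m i + 1)

theorem tailGaps_zero {r : ℕ} (m : Fin (r + 1) → ℕ) :
    tailGaps m 0 = m 0 + 1 + ∑ i : Fin r, (m i.succ + 1) := by
  unfold tailGaps
  rw [← Fin.sum_univ_succ (f := fun i => m i + 1)]
  congr 1
  ext i; simp

theorem tailGaps_succ {r : ℕ} (m : Fin (r + 1) → ℕ) (j : Fin r) :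
    tailGaps m j.succ = tailGaps (fun i => m i.succ) j := by
  simp [tailGaps, ← Fin.map_succEmb_Ici]

/-- Tonelli on the region 0 < y < u: the y-integral has an explicit antiderivative and produces both
the factor 1 / (n + 1) and the new power. -/
theorem lintegral_Ioi_mul_expWeight {g : ℝ → ℝ≥0∞} (hg : Measurable g) (n : ℕ) :
    ∫⁻ y in Ioi 0, (∫⁻ u in Ioi y, g u) * ENNReal.ofReal (expWeight n y) =
      ENNReal.ofReal (1 / (n + 1)) *
        ∫⁻ u in Ioi 0, g u * ENNReal.ofReal ((1 - Real.exp (-u)) ^ (n + 1)) := by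
  have hm : Measurable fun z : ℝ × ℝ =>
      {z : ℝ × ℝ | z.1 < z.2}.indicator
        (fun z => g z.2 * ENNReal.ofReal (expWeight n z.1)) z := by
    refine Measurable.indicator ?_ (measurableSet_lt measurable_fst measurable_snd)
    have := (continuous_expWeight n).measurable
    fun_prop
  have h1 : ∀ y ∈ Ioi (0 : ℝ), (∫⁻ u in Ioi y, g u) * ENNReal.ofReal (expWeight n y) =
      ∫⁻ u in Ioi 0, {z : ℝ × ℝ | z.1 < z.2}.indicator
        (fun z => g z.2 * ENNReal.ofReal (expWeight n z.1)) (y, u) := by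
    intro y hy
    rw [mem_Ioi] at hy
    rw [← lintegral_mul_const _ hg, ← lintegral_indicator measurableSet_Ioi,
      ← lintegral_indicator measurableSet_Ioi]
    refine lintegral_congr fun u => ?_
    simp only [indicator_apply, mem_Ioi, mem_ofPred_eq]
    by_cases h : y < u
    · simp [h, hy.trans h]
    · simp [h]
  rw [setLIntegral_congr_fun measurableSet_Ioi h1, lintegral_lintegral_swap hm.aemeasurable,
    ← lintegral_const_mul _ (by fun_prop)]
  refine setLIntegral_congr_fun measurableSet_Ioi fun u hu => ?_
  rw [mem_Ioi] at hu
  have h2 : ∀ y, (Ioi (0 : ℝ)).indicator (fun y => {z : ℝ × ℝ | z.1 < z.2}.indicator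
      (fun z => g z.2 * ENNReal.ofReal (expWeight n z.1)) (y, u)) y =
      (Ioo 0 u).indicator (fun y => g u * ENNReal.ofReal (expWeight n y)) y := by
    intro y
    simp only [indicator_apply, mem_Ioi, mem_ofPred_eq, mem_Ioo]
    by_cases h : 0 < y <;> simp [h]
  rw [← lintegral_indicator measurableSet_Ioi]
  simp_rw [h2]
  rw [lintegral_indicator measurableSet_Ioo, restrict_Ioo_eq_restrict_Ioc,
    lintegral_const_mul _ (by have := (continuous_expWeight n).measurable; fun_prop),
    lintegral_expWeight_Ioc n hu.le, ← one_div_mul_eq_div,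
    ENNReal.ofReal_mul (by positivity)]
  ring

/-- The iterated integral of a product of `expWeight`s at the tail sums. -/
theorem lintegral_tailSum {r : ℕ} {h : ℝ → ℝ≥0∞} (hh : Measurable h) (m : Fin (r + 1) → ℕ) :
    ∫⁻ x, h (tailSum x 0) * ∏ j, ENNReal.ofReal (expWeight (m j) (tailSum x j))
        ∂orthantMeasure (r + 1) =
      (∏ j : Fin r, ENNReal.ofReal (1 / (tailGaps m j.succ : ℝ))) *
        ∫⁻ u in Ioi 0, h u * ENNReal.ofReal (expWeight (tailGaps m 0 - 1) u) := by
  have hmeas : ∀ n, Measurable (expWeight n) := fun n => (continuous_expWeight n).measurable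
  have hm : ∀ (r : ℕ) (h : ℝ → ℝ≥0∞) (_ : Measurable h) (m : Fin (r + 1) → ℕ),
      Measurable fun x : Fin (r + 1) → ℝ =>
        h (tailSum x 0) * ∏ j, ENNReal.ofReal (expWeight (m j) (tailSum x j)) := by
    intro r h hh m
    refine (hh.comp (continuous_tailSum 0).measurable).mul
      (Finset.measurable_prod _ fun j _ => ?_)
    exact ((hmeas _).comp (continuous_tailSum j).measurable).ennreal_ofReal
  induction r generalizing h with
  | zero =>
    rw [lintegral_orthantMeasure_succ (hm _ _ hh _), lintegral_orthantMeasure_zero]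
    simp [tailSum_zero, tailGaps_zero]
  | succ r ih =>
    rw [lintegral_orthantMeasure_succ (hm _ _ hh _)]
    -- Integrating out the first variable leaves a function of the next tail sum alone. It takes
    -- over the role of h, which is why the induction is over arbitrary h.
    let H : ℝ → ℝ≥0∞ := fun y => ∫⁻ u in Ioi y, h u * ENNReal.ofReal (expWeight (m 0) u)
    have hH : Measurable H := by
      refine Antitone.measurable fun y z hyz => ?_
      exact lintegral_mono_set (Ioi_subset_Ioi hyz)
    have h1 : ∀ x : Fin (r + 1) → ℝ,
        ∫⁻ a in Ioi 0, h (tailSum (Fin.cons a x : Fin (r + 1 + 1) → ℝ) 0) *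
          ∏ j, ENNReal.ofReal (expWeight (m j) (tailSum (Fin.cons a x : Fin (r + 1 + 1) → ℝ) j)) =
        H (tailSum x 0) * ∏ j : Fin (r + 1),
          ENNReal.ofReal (expWeight (m j.succ) (tailSum x j)) := by
      intro x
      rw [show H (tailSum x 0) = _ from (lintegral_Ioi_add_right
          (fun u => h u * ENNReal.ofReal (expWeight (m 0) u)) (tailSum x 0)).symm,
        ← lintegral_mul_const _ (by fun_prop)]
      refine lintegral_congr fun a => ?_
      rw [Fin.prod_univ_succ]
      simp only [tailSum_cons_succ]
      rw [tailSum_zero, Fin.sum_univ_succ, tailSum_zero]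
      simp [mul_assoc]
    simp_rw [h1]
    rw [ih hH, lintegral_Ioi_mul_expWeight (by fun_prop), ← mul_assoc]
    have h0 : 0 < tailGaps (fun i : Fin (r + 1) => m i.succ) 0 := by
      rw [tailGaps_zero]; omega
    -- The power gained from the exchange of integrals adds to the power m 0 already present.
    have h2 : tailGaps m 0 - 1 = m 0 + (tailGaps (fun i : Fin (r + 1) => m i.succ) 0 - 1 + 1) := by
      rw [tailGaps_zero, tailGaps_zero, Fin.sum_univ_succ]; omega
    congr 1
    · rw [Fin.prod_univ_succ, mul_comm]
      simp only [tailGaps_succ]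
      congr 2
      rw [← Nat.cast_succ, Nat.succ_eq_add_one, Nat.sub_add_cancel h0]
    · refine setLIntegral_congr_fun measurableSet_Ioi fun u hu => ?_
      rw [mem_Ioi] at hu
      rw [mul_assoc, ← ENNReal.ofReal_mul (expWeight_nonneg _ hu.le), h2]
      simp only [expWeight, pow_add, mul_assoc]

/-! ### Expansion and integration of the kernel -/

theorem ENNReal_prod_tsum {r : ℕ} (f : Fin r → ℕ → ℝ≥0∞) :
    ∏ j, ∑' m, f j m = ∑' m : Fin r → ℕ, ∏ j, f j (m j) := by
  induction r with
  | zero =>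
    rw [tsum_eq_single default fun n hn => absurd (Subsingleton.elim _ _) hn]
    simp
  | succ r ih =>
    rw [tsum_snoc, Fin.prod_univ_castSucc, ih, ← ENNReal.tsum_mul_left]
    congr 1 with N
    rw [← ENNReal.tsum_mul_right]
    congr 1 with m
    simp [Fin.prod_univ_castSucc]

theorem exp_add_exp_sub_one_pos {x : ℝ} (hx : 0 < x) (t : ℝ) :
    0 < Real.exp x + Real.exp t - 1 := by
  have := Real.one_lt_exp_iff.2 hx
  have := Real.exp_pos t
  linarith

/-- Geometric series for e ^ x + e ^ t - 1 = e ^ (x + t) (1 - (1 - e ^ (-x)) (1 - e ^ (-t))). It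
separates x from t. -/
theorem ofReal_one_div_exp_add_exp_sub_one {x t : ℝ} (hx : 0 < x) (ht : 0 < t) :
    ENNReal.ofReal (1 / (Real.exp x + Real.exp t - 1)) =
      ∑' m, ENNReal.ofReal (expWeight m x) * ENNReal.ofReal (expWeight m t) := by
  have h1 : Real.exp (-x) < 1 := by rw [Real.exp_lt_one_iff]; linarith
  have h2 : Real.exp (-t) < 1 := by rw [Real.exp_lt_one_iff]; linarith
  have h1' := Real.exp_pos (-x)
  have h2' := Real.exp_pos (-t)
  have hr0 : 0 ≤ (1 - Real.exp (-x)) * (1 - Real.exp (-t)) :=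
    mul_nonneg (by linarith) (by linarith)
  have hr1 : (1 - Real.exp (-x)) * (1 - Real.exp (-t)) < 1 := by nlinarith
  have hs := (hasSum_geometric_of_lt_one hr0 hr1).mul_left (Real.exp (-x) * Real.exp (-t))
  have hs' : HasSum (fun m => expWeight m x * expWeight m t)
      (1 / (Real.exp x + Real.exp t - 1)) := by
    have h4 : 1 / (Real.exp x + Real.exp t - 1) = Real.exp (-x) * Real.exp (-t) *
        (1 - (1 - Real.exp (-x)) * (1 - Real.exp (-t)))⁻¹ := by
      have h3 := exp_add_exp_sub_one_pos hx t
      rw [← div_eq_mul_inv, div_eq_div_iff h3.ne' (by linarith)]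
      have e1 : Real.exp (-x) * Real.exp x = 1 := by rw [← Real.exp_add]; simp
      have e2 : Real.exp (-t) * Real.exp t = 1 := by rw [← Real.exp_add]; simp
      linear_combination (-Real.exp (-t)) * e1 - Real.exp (-x) * e2
    rw [h4]
    refine hs.congr_fun fun m => ?_
    simp only [expWeight, mul_pow]; ring
  have hnn : ∀ m, 0 ≤ expWeight m x * expWeight m t := fun m =>
    mul_nonneg (expWeight_nonneg m hx.le) (expWeight_nonneg m ht.le)
  rw [← hs'.tsum_eq, ENNReal.ofReal_tsum_of_nonneg hnn hs'.summable]
  congr 1 with m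
  rw [ENNReal.ofReal_mul (expWeight_nonneg m hx.le)]

/-- The kernel `∏ 1 / (e ^ (x_j + ⋯ + x_r) + e ^ (t_j + ⋯ + t_r) - 1)`. -/
def etaKernel {r : ℕ} (t x : Fin r → ℝ) : ℝ :=
  ∏ j, 1 / (Real.exp (tailSum x j) + Real.exp (tailSum t j) - 1)

theorem etaKernel_nonneg {r : ℕ} (t : Fin r → ℝ) {x : Fin r → ℝ}
    (hx : x ∈ posOrthant r) : 0 ≤ etaKernel t x :=
  Finset.prod_nonneg fun j _ =>
    (one_div_pos.2 (exp_add_exp_sub_one_pos (tailSum_pos hx j) _)).le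

@[fun_prop]
theorem measurable_etaKernel (r : ℕ) :
    Measurable fun z : (Fin r → ℝ) × (Fin r → ℝ) => etaKernel z.1 z.2 := by
  unfold etaKernel
  refine Finset.measurable_prod _ fun j _ => Measurable.const_div (Continuous.measurable ?_) _
  have := continuous_tailSum j
  fun_prop

theorem ae_prod_mem_posOrthant (r : ℕ) :
    ∀ᵐ z ∂(orthantMeasure r).prod (orthantMeasure r), z.1 ∈ posOrthant r ∧ z.2 ∈ posOrthant r := by
  have h1 := Measure.quasiMeasurePreserving_fst (μ := orthantMeasure r) (ν := orthantMeasure r)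
    |>.ae (ae_mem_posOrthant r)
  have h2 := Measure.quasiMeasurePreserving_snd (μ := orthantMeasure r) (ν := orthantMeasure r)
    |>.ae (ae_mem_posOrthant r)
  filter_upwards [h1, h2] with z h1 h2 using ⟨h1, h2⟩

theorem lintegral_pow_tailSum (s p : ℕ) (m : Fin (s + 1) → ℕ) :
    ∫⁻ x, ENNReal.ofReal (tailSum x 0 ^ p / p !) *
        ∏ j, ENNReal.ofReal (expWeight (m j) (tailSum x j)) ∂orthantMeasure (s + 1) =
      (∏ j, ENNReal.ofReal (1 / (tailGaps m j : ℝ))) *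
        ENNReal.ofReal (harmonicStar p (tailGaps m 0)) := by
  have h0 : 0 < tailGaps m 0 := by rw [tailGaps_zero]; omega
  have h := lintegral_tailSum (h := fun u => ENNReal.ofReal (u ^ p / p !)) (by fun_prop) m
  rw [h, lintegral_pow_mul_expWeight, Nat.sub_add_cancel h0, ← Nat.cast_succ,
    Nat.succ_eq_add_one, Nat.sub_add_cancel h0, ← one_div_mul_eq_div,
    ENNReal.ofReal_mul (by positivity), Fin.prod_univ_succ]
  ring

/-- Identifies the denominators from the integration with the entries of an increasing tuple, read
backwards. -/
theorem tailGaps_rev {r : ℕ} (m : Fin r → ℕ) (j : Fin r) :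
    tailGaps m j = (gapEquiv r (m ∘ Fin.rev) : Fin r → ℕ) j.rev := by
  rw [gapEquiv_apply, tailGaps]
  refine Finset.sum_bij' (fun i _ => i.rev) (fun i _ => i.rev) ?_ ?_ ?_ ?_ ?_ <;>
    simp [Fin.le_rev_iff]

/-- The integral of powers of the first tail sums against the kernel. -/
theorem lintegral_etaKernel (s p q : ℕ) :
    ∫⁻ z, ENNReal.ofReal (tailSum z.2 0 ^ p / p ! * (tailSum z.1 0 ^ q / q !) *
        etaKernel z.1 z.2) ∂(orthantMeasure (s + 1)).prod (orthantMeasure (s + 1)) =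
      ∑' n : increasingTuples (s + 1), starWeight s p q n := by
  have hmeas : ∀ n, Measurable (expWeight n) := fun n => (continuous_expWeight n).measurable
  have htail : ∀ j, Measurable fun x : Fin (s + 1) → ℝ => tailSum x j := fun j =>
    (continuous_tailSum j).measurable
  let G : ℕ → (Fin (s + 1) → ℕ) → (Fin (s + 1) → ℝ) → ℝ≥0∞ := fun p m x =>
    ENNReal.ofReal (tailSum x 0 ^ p / p !) *
      ∏ j, ENNReal.ofReal (expWeight (m j) (tailSum x j))
  have hG : ∀ p m, Measurable (G p m) := by
    intro p m
    refine Measurable.mul (by fun_prop) (Finset.measurable_prod _ fun j _ => ?_)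
    exact ((hmeas _).comp (htail j)).ennreal_ofReal
  -- After expansion the integral factors for each m. Both factors contain ∏ 1 / `tailGaps m j`,
  -- whence the squares.
  have h1 : ∀ᵐ z ∂(orthantMeasure (s + 1)).prod (orthantMeasure (s + 1)),
      ENNReal.ofReal (tailSum z.2 0 ^ p / p ! * (tailSum z.1 0 ^ q / q !) *
        etaKernel z.1 z.2) = ∑' m : Fin (s + 1) → ℕ, G q m z.1 * G p m z.2 := by
    filter_upwards [ae_prod_mem_posOrthant (s + 1)] with z hz
    have ht := tailSum_pos hz.1
    have hx := tailSum_pos hz.2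
    have ht0 := (ht 0).le
    have hx0 := (hx 0).le
    rw [ENNReal.ofReal_mul (by positivity), ENNReal.ofReal_mul (by positivity), etaKernel,
      ENNReal.ofReal_prod_of_nonneg fun j _ =>
        (one_div_pos.2 (exp_add_exp_sub_one_pos (hx j) _)).le]
    simp_rw [fun j => ofReal_one_div_exp_add_exp_sub_one (hx j) (ht j)]
    rw [ENNReal_prod_tsum, ← ENNReal.tsum_mul_left]
    congr 1 with m
    simp only [G, Finset.prod_mul_distrib]
    ring
  have h2 : ∀ m, Measurable fun z : (Fin (s + 1) → ℝ) × (Fin (s + 1) → ℝ) =>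
      G q m z.1 * G p m z.2 := fun m =>
    ((hG q m).comp measurable_fst).mul ((hG p m).comp measurable_snd)
  rw [lintegral_congr_ae h1, lintegral_tsum fun m => (h2 m).aemeasurable]
  simp_rw [fun m => lintegral_prod_mul (μ := orthantMeasure (s + 1))
    (ν := orthantMeasure (s + 1)) (hG q m).aemeasurable (hG p m).aemeasurable]
  simp only [G, lintegral_pow_tailSum]
  rw [← (gapEquiv (s + 1)).tsum_eq fun n => starWeight s p q n,
    ← (Equiv.arrowCongr (Fin.revPerm (n := s + 1)) (Equiv.refl ℕ)).tsum_eq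
      fun m => starWeight s p q (gapEquiv (s + 1) m)]
  congr 1 with m
  have hm : (Equiv.arrowCongr (Fin.revPerm (n := s + 1)) (Equiv.refl ℕ)) m = m ∘ Fin.rev := rfl
  rw [hm, starWeight, ← Fin.rev_zero, ← tailGaps_rev,
    ENNReal.ofReal_prod_of_nonneg fun _ _ => by positivity]
  have : ∏ j, ENNReal.ofReal (1 / ((gapEquiv (s + 1) (m ∘ Fin.rev) : Fin (s + 1) → ℕ) j : ℝ) ^ 2) =
      ∏ j, ENNReal.ofReal (1 / (tailGaps m j : ℝ) ^ 2) := by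
    rw [← Equiv.prod_comp Fin.revPerm]
    simp only [Fin.revPerm_apply, ← tailGaps_rev]
  rw [this]
  simp_rw [← one_div_pow, fun j => ENNReal.ofReal_pow (n := 2)
    (show 0 ≤ 1 / (tailGaps m j : ℝ) by positivity)]
  rw [Finset.prod_pow]
  ring

/-! ### Summation over the indices -/

/-- The monomial `∏ x_j ^ (k_j - 1) / (k_j - 1)!`. -/
def gammaWeight {r : ℕ} (k : Fin r → ℕ) (x : Fin r → ℝ) : ℝ :=
  ∏ j, x j ^ (k j - 1) / (k j - 1)!

theorem gammaWeight_nonneg {r : ℕ} (k : Fin r → ℕ) {x : Fin r → ℝ} (hx : x ∈ posOrthant r) :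
    0 ≤ gammaWeight k x :=
  Finset.prod_nonneg fun j _ => div_nonneg (pow_nonneg (hx j).le _) (by positivity)

@[fun_prop]
theorem continuous_gammaWeight {r : ℕ} (k : Fin r → ℕ) : Continuous (gammaWeight k) := by
  unfold gammaWeight; fun_prop

theorem mem_indexSet {k r : ℕ} {f : Fin r → ℕ} :
    f ∈ indexSet k r ↔ ∑ j, f j = k ∧ ∀ j, 0 < f j := by
  simp [indexSet]

theorem sum_sub_one {r : ℕ} {f : Fin r → ℕ} (hf : ∀ j, 0 < f j) :
    ∑ j, (f j - 1) + r = ∑ j, f j := by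
  calc ∑ j, (f j - 1) + r = ∑ j, (f j - 1 + 1) := by simp [Finset.sum_add_distrib]
    _ = _ := Finset.sum_congr rfl fun j _ => Nat.sub_add_cancel (hf j)

/-- The multinomial theorem for the exponents k_j - 1, whose sum is k - (s + 1). -/
theorem sum_gammaWeight {k s : ℕ} (hk : s + 1 ≤ k) (x : Fin (s + 1) → ℝ) :
    ∑ κ ∈ indexSet k (s + 1), gammaWeight κ x =
      tailSum x 0 ^ (k - (s + 1)) / (k - (s + 1))! := by
  rw [tailSum_zero, Finset.sum_pow_eq_sum_piAntidiag, Finset.sum_div]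
  refine Finset.sum_bij' (fun κ _ j => κ j - 1) (fun a _ j => a j + 1) ?_ ?_ ?_ ?_ ?_
  · intro κ hκ
    obtain ⟨h1, h2⟩ := mem_indexSet.1 hκ
    have := sum_sub_one h2
    simp; omega
  · intro a ha
    simp only [Finset.mem_piAntidiag] at ha
    rw [mem_indexSet]
    refine ⟨?_, fun j => Nat.succ_pos _⟩
    rw [Finset.sum_add_distrib, ha.1]
    simp; omega
  · intro κ hκ
    funext j
    exact Nat.sub_add_cancel ((mem_indexSet.1 hκ).2 j)
  · intro a ha
    funext j
    exact Nat.add_sub_cancel _ _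
  · intro κ hκ
    obtain ⟨h1, h2⟩ := mem_indexSet.1 hκ
    have h3 : ∑ j, (κ j - 1) = k - (s + 1) := by
      have := sum_sub_one h2
      omega
    have h4 := Nat.multinomial_spec Finset.univ fun j => κ j - 1
    rw [h3] at h4
    have h5 : (∏ j, ((κ j - 1)! : ℝ)) ≠ 0 :=
      Finset.prod_ne_zero_iff.2 fun j _ => by exact_mod_cast Nat.factorial_ne_zero _
    rw [gammaWeight, Finset.prod_div_distrib, ← h4]
    push_cast
    have h6 : (Nat.multinomial Finset.univ (fun j => κ j - 1) : ℝ) ≠ 0 := by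
      exact_mod_cast (Nat.multinomial_pos _ _).ne'
    field_simp

/-- The integrand of `η(k; l)` as a double integral. -/
def doubleIntegrand {r : ℕ} (k l : Fin r → ℕ) (z : (Fin r → ℝ) × (Fin r → ℝ)) : ℝ :=
  gammaWeight k z.2 * gammaWeight l z.1 * etaKernel z.1 z.2

theorem measurable_doubleIntegrand {r : ℕ} (k l : Fin r → ℕ) :
    Measurable (doubleIntegrand k l) := by
  have h1 := (continuous_gammaWeight k).measurable
  have h2 := (continuous_gammaWeight l).measurable
  unfold doubleIntegrand; fun_prop

theorem doubleIntegrand_nonneg {r : ℕ} (k l : Fin r → ℕ) {z : (Fin r → ℝ) × (Fin r → ℝ)}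
    (hz : z.1 ∈ posOrthant r ∧ z.2 ∈ posOrthant r) : 0 ≤ doubleIntegrand k l z :=
  mul_nonneg (mul_nonneg (gammaWeight_nonneg k hz.2) (gammaWeight_nonneg l hz.1))
    (etaKernel_nonneg _ hz.2)

theorem sum_lintegral_doubleIntegrand {k l s : ℕ} (hk : s + 1 ≤ k) (hl : s + 1 ≤ l) :
    ∑ κ ∈ indexSet k (s + 1), ∑ μ ∈ indexSet l (s + 1),
      ∫⁻ z, ENNReal.ofReal (doubleIntegrand κ μ z)
        ∂(orthantMeasure (s + 1)).prod (orthantMeasure (s + 1)) =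
      ENNReal.ofReal (zetaLin (sumFormulaIndex k l (s + 1))) := by
  rw [← tsum_starWeight_eq_zetaLin hk hl, ← lintegral_etaKernel]
  simp_rw [← lintegral_finsetSum _ fun μ _ =>
    (measurable_doubleIntegrand (r := s + 1) _ μ).ennreal_ofReal]
  rw [← lintegral_finsetSum _ fun κ _ => Finset.measurable_sum _ fun μ _ =>
    (measurable_doubleIntegrand κ μ).ennreal_ofReal]
  refine lintegral_congr_ae ?_
  filter_upwards [ae_prod_mem_posOrthant (s + 1)] with z hz
  simp_rw [← ENNReal.ofReal_sum_of_nonneg fun μ _ => doubleIntegrand_nonneg _ μ hz]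
  rw [← ENNReal.ofReal_sum_of_nonneg fun κ _ =>
      Finset.sum_nonneg fun μ _ => doubleIntegrand_nonneg κ μ hz,
    ← sum_gammaWeight hk, ← sum_gammaWeight hl, Finset.sum_mul_sum, Finset.sum_mul]
  simp only [Finset.sum_mul, doubleIntegrand]

/-- No separate estimate is needed: the integral is one summand of the sum formula in ℝ≥0∞, whose
total is finite. -/
theorem lintegral_doubleIntegrand_lt_top {s : ℕ} {k l : Fin (s + 1) → ℕ} (hk : ∀ j, 0 < k j)
    (hl : ∀ j, 0 < l j) :
    ∫⁻ z, ENNReal.ofReal (doubleIntegrand k l z)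
      ∂(orthantMeasure (s + 1)).prod (orthantMeasure (s + 1)) < ∞ := by
  have hc : ∀ f : Fin (s + 1) → ℕ, (∀ j, 0 < f j) → s + 1 ≤ ∑ j, f j := by
    intro f hf
    calc s + 1 = ∑ _j : Fin (s + 1), 1 := by simp
      _ ≤ _ := Finset.sum_le_sum fun j _ => hf j
  have h := sum_lintegral_doubleIntegrand (hc k hk) (hc l hl)
  have h1 := h.trans_lt ENNReal.ofReal_lt_top
  exact (ENNReal.sum_lt_top.1 (ENNReal.sum_lt_top.1 h1 k (mem_indexSet.2 ⟨rfl, hk⟩))) l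
    (mem_indexSet.2 ⟨rfl, hl⟩)

theorem integrable_doubleIntegrand {s : ℕ} {k l : Fin (s + 1) → ℕ} (hk : ∀ j, 0 < k j)
    (hl : ∀ j, 0 < l j) :
    Integrable (doubleIntegrand k l)
      ((orthantMeasure (s + 1)).prod (orthantMeasure (s + 1))) := by
  refine ⟨(measurable_doubleIntegrand k l).aestronglyMeasurable, ?_⟩
  rw [hasFiniteIntegral_iff_ofReal]
  · exact lintegral_doubleIntegrand_lt_top hk hl
  · filter_upwards [ae_prod_mem_posOrthant (s + 1)] with z hz using doubleIntegrand_nonneg k l hz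

theorem integral_doubleIntegrand {r : ℕ} (k l : Fin r → ℕ) :
    ∫ z, doubleIntegrand k l z ∂(orthantMeasure r).prod (orthantMeasure r) =
      (∫⁻ z, ENNReal.ofReal (doubleIntegrand k l z)
        ∂(orthantMeasure r).prod (orthantMeasure r)).toReal := by
  refine integral_eq_lintegral_of_nonneg_ae ?_
    (measurable_doubleIntegrand k l).aestronglyMeasurable
  filter_upwards [ae_prod_mem_posOrthant r] with z hz using doubleIntegrand_nonneg k l hz

theorem sum_integral_doubleIntegrand {k l s : ℕ} (hk : s + 1 ≤ k) (hl : s + 1 ≤ l) :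
    ∑ κ ∈ indexSet k (s + 1), ∑ μ ∈ indexSet l (s + 1),
      ∫ z, doubleIntegrand κ μ z ∂(orthantMeasure (s + 1)).prod (orthantMeasure (s + 1)) =
      zetaLin (sumFormulaIndex k l (s + 1)) := by
  rw [← ENNReal.toReal_ofReal (zetaLin_sumFormulaIndex_nonneg hk hl),
    ← sum_lintegral_doubleIntegrand hk hl, ENNReal.toReal_sum]
  · refine Finset.sum_congr rfl fun κ hκ => ?_
    rw [ENNReal.toReal_sum]
    · simp only [integral_doubleIntegrand]
    · intro μ hμ
      exact (lintegral_doubleIntegrand_lt_top (mem_indexSet.1 hκ).2 (mem_indexSet.1 hμ).2).ne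
  · intro κ hκ
    refine ENNReal.sum_ne_top.2 fun μ hμ => ?_
    exact (lintegral_doubleIntegrand_lt_top (mem_indexSet.1 hκ).2 (mem_indexSet.1 hμ).2).ne

/-! ### Uniqueness of the continuation -/

theorem isOpen_polylogRegion (r : ℕ) : IsOpen (polylogRegion r) := by
  have : polylogRegion r = ⋂ j, (fun z : Fin r → ℂ => 1 - z j) ⁻¹' Complex.slitPlane := by
    ext z; simp [polylogRegion]
  rw [this]
  exact isOpen_iInter_of_finite fun j => Complex.isOpen_slitPlane.preimage (by fun_prop)

/-- Restriction to the complex line through 0 and z reduces to the identity theorem in one variable.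
The preimage U of the region is star-shaped about 0, hence connected, and contains 1; near 0 both
functions are the series. -/
theorem IsPolylogContinuation.eqOn {r : ℕ} {s : Fin r → ℂ} {F G : (Fin r → ℂ) → ℂ}
    (hF : IsPolylogContinuation s F) (hG : IsPolylogContinuation s G) :
    EqOn F G (polylogRegion r) := by
  intro z hz
  let line : ℂ → Fin r → ℂ := fun c => c • z
  have hline : Differentiable ℂ line := by fun_prop
  let U : Set ℂ := line ⁻¹' polylogRegion r
  have hU : IsOpen U := (isOpen_polylogRegion r).preimage hline.continuous
  have hstar : StarConvex ℝ 0 U := by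
    intro c hc a b ha hb hab j
    have h := Complex.starConvex_one_slitPlane (hc j) ha hb hab
    convert h using 1
    simp only [line, Pi.smul_apply, smul_eq_mul, Complex.real_smul, mul_zero, zero_add, mul_one]
    have : (a : ℂ) + b = 1 := by exact_mod_cast hab
    linear_combination -this
  have hF' : AnalyticOnNhd ℂ (F ∘ line) U :=
    (hF.differentiableOn.comp hline.differentiableOn fun _ h => h).analyticOnNhd hU
  have hG' : AnalyticOnNhd ℂ (G ∘ line) U :=
    (hG.differentiableOn.comp hline.differentiableOn fun _ h => h).analyticOnNhd hU
  have h0 : (0 : ℂ) ∈ U := by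
    intro j
    simp [line]
  have hev : F ∘ line =ᶠ[𝓝 0] G ∘ line := by
    have : ∀ᶠ c in 𝓝 (0 : ℂ), ∀ j, ‖line c j‖ < 1 := by
      refine eventually_all.2 fun j => ?_
      have hc : Continuous fun c => ‖line c j‖ := by fun_prop
      exact hc.continuousAt.eventually_lt continuousAt_const (by simp [line])
    filter_upwards [this] with c hc
    exact (hF.hasSum _ hc).unique (hG.hasSum _ hc)
  have := hF'.eqOn_of_preconnected_of_eventuallyEq hG' (hstar.isPathConnected h0).isConnected.isPreconnected h0 hev
    (show (1 : ℂ) ∈ U by simpa [U, line] using hz)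
  simpa [line] using this

/-- `polylog` is a chosen continuation; by uniqueness any explicit one may replace it on the region.
-/
theorem polylog_eq {r : ℕ} {s : Fin r → ℂ} {F : (Fin r → ℂ) → ℂ}
    (hF : IsPolylogContinuation s F) {z : Fin r → ℂ} (hz : z ∈ polylogRegion r) :
    polylog s z = F z := by
  have h : ∃ F, IsPolylogContinuation s F := ⟨F, hF⟩
  rw [polylog, dif_pos h]
  exact h.choose_spec.eqOn hF hz

/-! ### The continuation as an integral -/

theorem exp_sub_ne_zero {w : ℂ} (hw : 1 - w ∈ Complex.slitPlane) {X : ℝ} (hX : 0 ≤ X) :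
    (Real.exp X : ℂ) - w ≠ 0 := by
  intro h
  rw [sub_eq_zero] at h
  rw [← h, Complex.mem_slitPlane_iff] at hw
  have := Real.one_le_exp hX
  rcases hw with hw | hw
  · rw [Complex.sub_re, Complex.one_re, Complex.ofReal_re] at hw
    linarith
  · rw [Complex.sub_im, Complex.one_im, Complex.ofReal_im] at hw
    simp at hw

/-- Put u = e ^ (-X) and take the minimum over the compact interval [0, 1]. The added endpoint u = 0
is harmless, since the value there is 1. -/
theorem exists_le_norm_one_sub_mul {w : ℂ} (hw : 1 - w ∈ Complex.slitPlane) :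
    ∃ c : ℝ, 0 < c ∧ ∀ X : ℝ, 0 ≤ X → c ≤ ‖1 - w * Real.exp (-X)‖ := by
  have hc : ContinuousOn (fun u : ℝ => ‖1 - w * u‖) (Icc 0 1) := by fun_prop
  obtain ⟨u, hu, hmin⟩ := isCompact_Icc.exists_isMinOn (nonempty_Icc.2 zero_le_one) hc
  refine ⟨‖1 - w * u‖, ?_, fun X hX => hmin ⟨(Real.exp_pos _).le, ?_⟩⟩
  · rw [norm_pos_iff]
    rcases hu.1.eq_or_lt with h | h
    · simp [← h]
    · intro h0
      have hX : 0 ≤ -Real.log u := by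
        rw [neg_nonneg]; exact Real.log_nonpos hu.1 hu.2
      apply exp_sub_ne_zero hw hX
      rw [Real.exp_neg, Real.exp_log h]
      have hu0 : (u : ℂ) ≠ 0 := by exact_mod_cast h.ne'
      push_cast
      field_simp
      linear_combination h0
  · rw [Real.exp_le_one_iff]; linarith

/-- A bound that is locally uniform in z, for differentiation under the integral. A lower bound d
for |1 - z₀ e ^ (-X)| remains d / 2 on the ball of radius d / 2, because e ^ (-X) ≤ 1. -/
theorem exists_norm_inv_exp_sub_le {r : ℕ} {z₀ : Fin r → ℂ} (hz : z₀ ∈ polylogRegion r) :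
    ∃ s ∈ 𝓝 z₀, ∃ C : ℝ, 0 ≤ C ∧ s ⊆ polylogRegion r ∧ ∀ z ∈ s, ∀ j, ∀ X : ℝ, 0 ≤ X →
      ‖((Real.exp X : ℂ) - z j)⁻¹‖ ≤ C * Real.exp (-X) := by
  choose c hc0 hc using fun j => exists_le_norm_one_sub_mul (hz j)
  have : ∀ᶠ d in 𝓝[>] (0 : ℝ), ∀ j, d ≤ c j :=
    eventually_all.2 fun j => by
      filter_upwards [Ioc_mem_nhdsGT (hc0 j)] with d hd using hd.2
  obtain ⟨d, hd, hd0⟩ := (this.and self_mem_nhdsWithin).exists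
  replace hd0 : 0 < d := hd0
  refine ⟨polylogRegion r ∩ Metric.ball z₀ (d / 2), inter_mem ((isOpen_polylogRegion r).mem_nhds hz)
    (Metric.ball_mem_nhds _ (by positivity)), 2 / d, by positivity, inter_subset_left, ?_⟩
  rintro z ⟨-, hzb⟩ j X hX
  have h1 : ‖z j - z₀ j‖ ≤ d / 2 := by
    rw [← dist_eq_norm]
    exact (dist_le_pi_dist z z₀ j).trans (Metric.mem_ball.1 hzb).le
  have hu1 : Real.exp (-X) ≤ 1 := by rw [Real.exp_le_one_iff]; linarith
  have h2 : d / 2 ≤ ‖1 - z j * Real.exp (-X)‖ := by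
    have h3 : 1 - z₀ j * Real.exp (-X) =
        (1 - z j * Real.exp (-X)) + (z j - z₀ j) * Real.exp (-X) := by ring
    have h4 : ‖(z j - z₀ j) * Real.exp (-X)‖ ≤ d / 2 := by
      rw [norm_mul, Complex.norm_real, Real.norm_of_nonneg (Real.exp_pos _).le]
      calc _ ≤ d / 2 * 1 := mul_le_mul h1 hu1 (Real.exp_pos _).le (by positivity)
        _ = d / 2 := mul_one _
    have h5 := (hd j).trans (hc j X hX)
    rw [h3] at h5
    have := h5.trans (norm_add_le _ _)
    linarith
  have h6 : (Real.exp X : ℂ) - z j = Real.exp X * (1 - z j * Real.exp (-X)) := by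
    have : (Real.exp X : ℂ) * Real.exp (-X) = 1 := by
      rw [← Complex.ofReal_mul, ← Real.exp_add]; simp
    linear_combination z j * this
  rw [h6, norm_inv, norm_mul, Complex.norm_real, Real.norm_of_nonneg (Real.exp_pos _).le, mul_inv,
    ← Real.exp_neg, mul_comm]
  refine mul_le_mul_of_nonneg_right ?_ (Real.exp_pos _).le
  rw [show 2 / d = (d / 2)⁻¹ by rw [inv_div]]
  exact inv_anti₀ (by positivity) h2

/-- The integrand of the integral representation of the polylogarithm. -/
def polylogIntegrand {r : ℕ} (k : Fin r → ℕ) (z : Fin r → ℂ) (x : Fin r → ℝ) : ℂ :=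
  gammaWeight k x * ∏ j, ((Real.exp (tailSum x j) : ℂ) - z j)⁻¹

/-- The integral representation of the polylogarithm. -/
def polylogIntegral {r : ℕ} (k : Fin r → ℕ) (z : Fin r → ℂ) : ℂ :=
  (∏ j, z j) * ∫ x, polylogIntegrand k z x ∂orthantMeasure r

theorem measurable_inv_exp_tailSum_sub {r : ℕ} (z : Fin r → ℂ) (j : Fin r) :
    Measurable fun x : Fin r → ℝ => ((Real.exp (tailSum x j) : ℂ) - z j)⁻¹ := by
  have := continuous_tailSum j
  exact (Continuous.measurable (by fun_prop)).inv

theorem measurable_polylogIntegrand {r : ℕ} (k : Fin r → ℕ) (z : Fin r → ℂ) :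
    Measurable (polylogIntegrand k z) := by
  refine Measurable.mul ?_ (Finset.measurable_prod _ fun j _ => measurable_inv_exp_tailSum_sub z j)
  exact (Complex.continuous_ofReal.comp (continuous_gammaWeight k)).measurable

theorem integrable_gammaWeight_mul_prod_exp {r : ℕ} {k : Fin r → ℕ} (hk : ∀ j, 0 < k j)
    {N : Fin r → ℕ} (hN : ∀ j, 0 < N j) :
    Integrable (fun x => gammaWeight k x * ∏ j, Real.exp (-(N j * x j))) (orthantMeasure r) ∧
      ∫ x, gammaWeight k x * ∏ j, Real.exp (-(N j * x j)) ∂orthantMeasure r =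
        ∏ j, 1 / (N j : ℝ) ^ k j := by
  have h1 : ∀ j, ∫ x in Ioi (0 : ℝ), x ^ (k j - 1) / (k j - 1)! * Real.exp (-(N j * x)) =
      1 / (N j : ℝ) ^ k j := by
    intro j
    have h := Real.integral_rpow_mul_exp_neg_mul_Ioi (a := k j) (r := N j)
      (by exact_mod_cast hk j) (by exact_mod_cast hN j)
    have h2 : (k j : ℝ) - 1 = ((k j - 1 : ℕ) : ℝ) := by
      rw [Nat.cast_sub (hk j), Nat.cast_one]
    have h3 : Real.Gamma (k j) = (k j - 1)! := by
      rw [← Real.Gamma_nat_eq_factorial, ← h2, sub_add_cancel]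
    simp only [h2, h3, Real.rpow_natCast] at h
    have h4 : ((k j - 1)! : ℝ) ≠ 0 := by exact_mod_cast Nat.factorial_ne_zero _
    simp_rw [div_mul_eq_mul_div, integral_div, h, one_div_pow]
    field_simp
  have h2 : (fun x : Fin r → ℝ => gammaWeight k x * ∏ j, Real.exp (-(N j * x j))) =
      fun x => ∏ j, (x j ^ (k j - 1) / (k j - 1)! * Real.exp (-(N j * x j))) := by
    funext x
    rw [gammaWeight, Finset.prod_mul_distrib]
  rw [h2]
  constructor
  · refine Integrable.fintype_prod_dep
      (f := fun j x => x ^ (k j - 1) / (k j - 1)! * Real.exp (-(N j * x))) fun j => ?_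
    -- The integral of a non-integrable function is 0 by convention, so the nonzero value just found
    -- already gives integrability.
    refine Integrable.of_integral_ne_zero ?_
    rw [h1]
    have : (0 : ℝ) < N j := by exact_mod_cast hN j
    positivity
  · rw [integral_fintype_prod_eq_prod
      fun j (x : ℝ) => x ^ (k j - 1) / (k j - 1)! * Real.exp (-(N j * x))]
    exact Finset.prod_congr rfl fun j _ => h1 j

/-- The integrable bound for the integrand. -/
def polylogBound {r : ℕ} (k : Fin r → ℕ) (x : Fin r → ℝ) : ℝ :=
  gammaWeight k x * ∏ j, Real.exp (-x j)

theorem integrable_polylogBound {r : ℕ} {k : Fin r → ℕ} (hk : ∀ j, 0 < k j) :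
    Integrable (polylogBound k) (orthantMeasure r) := by
  have := (integrable_gammaWeight_mul_prod_exp hk (N := fun _ => 1) fun _ => one_pos).1
  simp only [Nat.cast_one, one_mul] at this
  exact this

theorem le_tailSum {r : ℕ} {x : Fin r → ℝ} (hx : x ∈ posOrthant r) (j : Fin r) :
    x j ≤ tailSum x j :=
  Finset.single_le_sum (f := x) (fun i _ => (hx i).le) (by simp)

theorem norm_polylogIntegrand_le {r : ℕ} (k : Fin r → ℕ) {z : Fin r → ℂ} {C : ℝ} (hC : 0 ≤ C)
    (h : ∀ j, ∀ X : ℝ, 0 ≤ X → ‖((Real.exp X : ℂ) - z j)⁻¹‖ ≤ C * Real.exp (-X))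
    {x : Fin r → ℝ} (hx : x ∈ posOrthant r) :
    ‖polylogIntegrand k z x‖ ≤ C ^ r * polylogBound k x := by
  rw [polylogIntegrand, polylogBound, norm_mul, norm_prod, Complex.norm_real,
    Real.norm_of_nonneg (gammaWeight_nonneg k hx), mul_left_comm]
  refine mul_le_mul_of_nonneg_left ?_ (gammaWeight_nonneg k hx)
  calc ∏ j, ‖((Real.exp (tailSum x j) : ℂ) - z j)⁻¹‖ ≤ ∏ j, (C * Real.exp (-x j)) := by
        refine Finset.prod_le_prod (fun j _ => norm_nonneg _) fun j _ => ?_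
        refine (h j _ (tailSum_pos hx j).le).trans (mul_le_mul_of_nonneg_left ?_ hC)
        rw [Real.exp_le_exp, neg_le_neg_iff]
        exact le_tailSum hx j
    _ = _ := by rw [Finset.prod_mul_distrib]; simp

theorem hasFDerivAt_polylogIntegrand {r : ℕ} (k : Fin r → ℕ) {z : Fin r → ℂ}
    (hz : z ∈ polylogRegion r) {x : Fin r → ℝ} (hx : x ∈ posOrthant r) :
    HasFDerivAt (fun z => polylogIntegrand k z x)
      (polylogIntegrand k z x • ∑ j, ((Real.exp (tailSum x j) : ℂ) - z j)⁻¹ •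
        (ContinuousLinearMap.proj j : (Fin r → ℂ) →L[ℂ] ℂ)) z := by
  have hne : ∀ j, (Real.exp (tailSum x j) : ℂ) - z j ≠ 0 := fun j =>
    exp_sub_ne_zero (hz j) (tailSum_pos hx j).le
  have h1 : ∀ j, HasFDerivAt (fun z : Fin r → ℂ => ((Real.exp (tailSum x j) : ℂ) - z j)⁻¹)
      ((((Real.exp (tailSum x j) : ℂ) - z j) ^ 2)⁻¹ •
        (ContinuousLinearMap.proj j : (Fin r → ℂ) →L[ℂ] ℂ)) z := by
    intro j
    have h := (hasDerivAt_inv (hne j)).comp_hasFDerivAt z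
      (((ContinuousLinearMap.proj j : (Fin r → ℂ) →L[ℂ] ℂ)).hasFDerivAt.const_sub
        (Real.exp (tailSum x j) : ℂ))
    refine h.congr_fderiv ?_
    ext v
    simp
  have h2 := (HasFDerivAt.finsetProd (u := Finset.univ) fun j _ => h1 j).const_mul
    (gammaWeight k x : ℂ)
  refine h2.congr_fderiv ?_
  rw [Finset.smul_sum, Finset.smul_sum]
  refine Finset.sum_congr rfl fun j _ => ?_
  rw [smul_smul, smul_smul, smul_smul]
  congr 1
  rw [polylogIntegrand, ← Finset.mul_prod_erase _ _ (Finset.mem_univ j)]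
  have := hne j
  field_simp

theorem differentiableOn_polylogIntegral {r : ℕ} {k : Fin r → ℕ} (hk : ∀ j, 0 < k j) :
    DifferentiableOn ℂ (polylogIntegral k) (polylogRegion r) := by
  intro z₀ hz
  refine DifferentiableAt.differentiableWithinAt ?_
  obtain ⟨s, hs, C, hC, hsub, hbound⟩ := exists_norm_inv_exp_sub_le hz
  refine DifferentiableAt.mul (by fun_prop) ?_
  refine (hasFDerivAt_integral_of_dominated_of_fderiv_le (s := s)
    (F := fun z x => polylogIntegrand k z x)
    (F' := fun z x => polylogIntegrand k z x •
      ∑ j, ((Real.exp (tailSum x j) : ℂ) - z j)⁻¹ •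
        (ContinuousLinearMap.proj j : (Fin r → ℂ) →L[ℂ] ℂ))
    -- The factor r C bounds the logarithmic derivative, a sum of r inverses of norm at most C times
    -- coordinate projections.
    (bound := fun x => (C ^ r * polylogBound k x) * (r * C)) hs ?_ ?_ ?_ ?_ ?_ ?_).differentiableAt
  · exact Eventually.of_forall fun z => (measurable_polylogIntegrand k z).aestronglyMeasurable
  · refine Integrable.mono' ((integrable_polylogBound hk).const_mul (C ^ r))
      (measurable_polylogIntegrand k z₀).aestronglyMeasurable ?_
    filter_upwards [ae_mem_posOrthant r] with x hx
    exact norm_polylogIntegrand_le k hC (hbound z₀ (mem_of_mem_nhds hs)) hx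
  · refine (measurable_polylogIntegrand k z₀).aestronglyMeasurable.smul ?_
    refine Finset.aestronglyMeasurable_fun_sum _ fun j _ => ?_
    exact (measurable_inv_exp_tailSum_sub z₀ j).aestronglyMeasurable.smul_const _
  · filter_upwards [ae_mem_posOrthant r] with x hx z hz
    rw [norm_smul]
    refine mul_le_mul (norm_polylogIntegrand_le k hC (hbound z hz) hx) ?_ (norm_nonneg _)
      ((norm_nonneg _).trans (norm_polylogIntegrand_le k hC (hbound z hz) hx))
    calc _ ≤ ∑ j : Fin r, C := norm_sum_le_of_le _ fun j _ => ?_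
      _ = r * C := by simp
    rw [norm_smul]
    have h1 : ‖(ContinuousLinearMap.proj j : (Fin r → ℂ) →L[ℂ] ℂ)‖ ≤ 1 :=
      ContinuousLinearMap.opNorm_le_bound _ zero_le_one fun v => by
        simpa using norm_le_pi_norm v j
    have h2 := hbound z hz j _ (tailSum_pos hx j).le
    have h3 : Real.exp (-tailSum x j) ≤ 1 := by
      rw [Real.exp_le_one_iff]; linarith [tailSum_pos hx j]
    calc _ ≤ C * 1 := mul_le_mul (h2.trans (mul_le_of_le_one_right hC h3)) h1 (norm_nonneg _) hC
      _ = C := mul_one C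
  · exact ((integrable_polylogBound hk).const_mul _).mul_const _
  · filter_upwards [ae_mem_posOrthant r] with x hx z hz
    exact hasFDerivAt_polylogIntegrand k (hsub hz) hx

/-! ### The series on the unit polydisc -/

theorem hasSum_fin_prod {r : ℕ} {f : Fin r → ℕ → ℂ} (hf : ∀ j, Summable fun m => ‖f j m‖) :
    (Summable fun m : Fin r → ℕ => ‖∏ j, f j (m j)‖) ∧
      HasSum (fun m : Fin r → ℕ => ∏ j, f j (m j)) (∏ j, ∑' m, f j m) := by
  induction r with
  | zero =>
    constructor
    · exact (hasSum_fintype _).summable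
    · convert hasSum_fintype (fun m : Fin 0 → ℕ => ∏ j, f j (m j))
      simp
  | succ r ih =>
    obtain ⟨h1, h2⟩ := ih fun j => hf j.castSucc
    have h3 := hf (Fin.last r)
    let e₀ : ℕ × (Fin r → ℕ) ≃ (Fin (r + 1) → ℕ) := Fin.snocEquiv fun _ => ℕ
    have e : ∀ m : ℕ × (Fin r → ℕ),
        ∏ j, f j (e₀ m j) =
          f (Fin.last r) m.1 * ∏ j : Fin r, f j.castSucc (m.2 j) := by
      intro m
      rw [Fin.prod_univ_castSucc, mul_comm]
      simp [e₀, Fin.snocEquiv]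
    rw [← e₀.summable_iff, ← e₀.hasSum_iff]
    simp only [Function.comp_def, e]
    have h5 : Summable fun m : ℕ × (Fin r → ℕ) =>
        ‖f (Fin.last r) m.1 * ∏ j : Fin r, f j.castSucc (m.2 j)‖ :=
      Summable.mul_norm (f := f (Fin.last r))
        (g := fun m : Fin r → ℕ => ∏ j : Fin r, f j.castSucc (m j)) h3 h1
    refine ⟨h5, ?_⟩
    rw [Fin.prod_univ_castSucc, mul_comm]
    have h4 : Summable fun m : ℕ × (Fin r → ℕ) =>
        f (Fin.last r) m.1 * ∏ j : Fin r, f j.castSucc (m.2 j) := h5.of_norm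
    exact HasSum.mul (f := f (Fin.last r))
      (g := fun m : Fin r → ℕ => ∏ j : Fin r, f j.castSucc (m j)) h3.of_norm.hasSum h2 h4

/-- Exchanging the two summations turns gaps paired with tail sums into partial sums n_i paired with
single variables, so the integrals split into Gamma integrals. -/
theorem prod_exp_tailSum {r : ℕ} (m : Fin r → ℕ) (x : Fin r → ℝ) :
    ∏ j, Real.exp (-tailSum x j) ^ (m j + 1) =
      ∏ i, Real.exp (-((gapEquiv r m : Fin r → ℕ) i * x i)) := by
  simp_rw [← Real.exp_nat_mul, ← Real.exp_sum]
  congr 1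
  simp only [mul_neg, Finset.sum_neg_distrib, neg_inj, gapEquiv_apply, tailSum, Nat.cast_sum,
    Finset.mul_sum, Finset.sum_mul]
  refine Finset.sum_comm' ?_
  simp

/-- Each 1 / (e ^ X - z_j) is expanded as Σ z_j ^ m e ^ (-(m + 1) X) and integrated term by term. -/
theorem hasSum_polylogIntegral {r : ℕ} {k : Fin r → ℕ} (hk : ∀ j, 0 < k j) {z : Fin r → ℂ}
    (hz : ∀ j, ‖z j‖ < 1) :
    HasSum (fun n : increasingTuples r => polylogTerm (fun j => (k j : ℂ)) z n)
      (polylogIntegral k z) := by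
  have hN : ∀ m j, 0 < (gapEquiv r m : Fin r → ℕ) j := fun m => (gapEquiv r m).2.2
  let g : (Fin r → ℕ) → (Fin r → ℝ) → ℝ := fun m x =>
    gammaWeight k x * ∏ j, Real.exp (-tailSum x j) ^ (m j + 1)
  have hg : ∀ m, Integrable (g m) (orthantMeasure r) ∧
      ∫ x, g m x ∂orthantMeasure r = ∏ j, 1 / ((gapEquiv r m : Fin r → ℕ) j : ℝ) ^ k j := by
    intro m
    simp only [g, prod_exp_tailSum]
    exact integrable_gammaWeight_mul_prod_exp hk (hN m)
  have hgeom : Summable fun m : Fin r → ℕ => ‖∏ j, z j ^ m j‖ :=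
    (hasSum_fin_prod (f := fun j m => z j ^ m) fun j => by
      simpa using summable_geometric_of_lt_one (norm_nonneg _) (hz j)).1
  have h1 := hasSum_integral_of_summable_integral_norm (μ := orthantMeasure r)
    (F := fun (m : Fin r → ℕ) x => (∏ j, z j ^ m j) * (g m x : ℂ))
    (fun m => (hg m).1.ofReal.const_mul _) ?_
  · rw [← (gapEquiv r).hasSum_iff]
    have h2 := h1.mul_left (∏ j, z j)
    have hval : polylogIntegral k z = (∏ j, z j) *
        ∫ x, ∑' m : Fin r → ℕ, (∏ j, z j ^ m j) * (g m x : ℂ) ∂orthantMeasure r := ?_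
    · rw [hval]
      refine h2.congr_fun fun m => ?_
      rw [integral_const_mul, integral_complex_ofReal, (hg m).2]
      simp only [Function.comp_apply, polylogTerm]
      rw [Complex.ofReal_prod, ← Finset.prod_mul_distrib, ← Finset.prod_mul_distrib]
      refine Finset.prod_congr rfl fun j _ => ?_
      -- The exponent of z_j is the gap m_j + 1; the power beyond m_j is the prefactor z_j of
      -- `polylogIntegral`.
      have h3 := gapEquiv_sub_prevValue m j
      rw [prevValue] at h3
      rw [h3, Complex.cpow_natCast, pow_succ]
      push_cast
      ring
    · rw [polylogIntegral]
      congr 1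
      refine integral_congr_ae ?_
      filter_upwards [ae_mem_posOrthant r] with x hx
      have h3 : ∀ j, HasSum (fun m : ℕ => z j ^ m * (Real.exp (-tailSum x j) : ℂ) ^ (m + 1))
          ((Real.exp (tailSum x j) : ℂ) - z j)⁻¹ ∧
          Summable fun m : ℕ => ‖z j ^ m * (Real.exp (-tailSum x j) : ℂ) ^ (m + 1)‖ := by
        intro j
        have hX : Real.exp (-tailSum x j) ≤ 1 := by
          rw [Real.exp_le_one_iff]; linarith [tailSum_pos hx j]
        have hlt : ‖z j * (Real.exp (-tailSum x j) : ℂ)‖ < 1 := by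
          rw [norm_mul, Complex.norm_real, Real.norm_of_nonneg (Real.exp_pos _).le]
          exact (mul_le_of_le_one_right (norm_nonneg _) hX).trans_lt (hz j)
        have e : ∀ m : ℕ, z j ^ m * (Real.exp (-tailSum x j) : ℂ) ^ (m + 1) =
            (Real.exp (-tailSum x j) : ℂ) * (z j * (Real.exp (-tailSum x j) : ℂ)) ^ m := by
          intro m; rw [mul_pow, pow_succ]; ring
        simp only [e]
        constructor
        · have h4 := (hasSum_geometric_of_norm_lt_one hlt).mul_left
            (Real.exp (-tailSum x j) : ℂ)
          have h5 : (Real.exp (tailSum x j) : ℂ) - z j =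
              Real.exp (tailSum x j) * (1 - z j * Real.exp (-tailSum x j)) := by
            have : (Real.exp (tailSum x j) : ℂ) * Real.exp (-tailSum x j) = 1 := by
              rw [← Complex.ofReal_mul, ← Real.exp_add]; simp
            linear_combination z j * this
          rw [h5, mul_inv, ← Complex.ofReal_inv, ← Real.exp_neg]
          exact h4
        · simp_rw [norm_mul _ ((_ : ℂ) ^ _), norm_pow]
          exact (summable_geometric_of_lt_one (norm_nonneg _) hlt).mul_left _
      have h4 := (hasSum_fin_prod fun j => (h3 j).2).2.mul_left (gammaWeight k x : ℂ)
      simp only [fun j => (h3 j).1.tsum_eq] at h4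
      rw [polylogIntegrand, ← h4.tsum_eq]
      congr 1 with m
      simp only [g]
      push_cast
      rw [Finset.prod_mul_distrib]
      ring
  · refine Summable.of_nonneg_of_le (fun m => integral_nonneg fun x => norm_nonneg _) (fun m => ?_)
      hgeom
    have h2 : ∀ᵐ x ∂orthantMeasure r,
        ‖(∏ j, z j ^ m j) * (g m x : ℂ)‖ = ‖∏ j, z j ^ m j‖ * g m x := by
      filter_upwards [ae_mem_posOrthant r] with x hx
      rw [norm_mul, Complex.norm_real, Real.norm_of_nonneg]
      exact mul_nonneg (gammaWeight_nonneg k hx) (Finset.prod_nonneg fun _ _ => by positivity)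
    rw [integral_congr_ae h2, integral_const_mul, (hg m).2]
    -- The integrals are at most 1, so the multiple geometric series in |z_j| dominates.
    refine mul_le_of_le_one_right (norm_nonneg _) ?_
    refine Finset.prod_le_one (fun _ _ => by positivity) fun j _ => ?_
    rw [div_le_one (by have := hN m j; positivity)]
    exact one_le_pow₀ (by exact_mod_cast hN m j)

/-- The integral is the continuation of the polylogarithm. -/
theorem isPolylogContinuation_polylogIntegral {r : ℕ} {k : Fin r → ℕ} (hk : ∀ j, 0 < k j) :
    IsPolylogContinuation (fun j => (k j : ℂ)) (polylogIntegral k) :=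
  ⟨differentiableOn_polylogIntegral hk, fun _ hz => hasSum_polylogIntegral hk hz⟩

/-! ### The eta function at indices -/

theorem oneSubExp_eq {r : ℕ} (t : Fin r → ℝ) (j : Fin r) :
    oneSubExp t j = 1 - (Real.exp (tailSum t j) : ℂ) := by
  rw [oneSubExp, tailSum, Complex.ofReal_exp]

theorem oneSubExp_mem_polylogRegion {r : ℕ} (t : Fin r → ℝ) :
    oneSubExp t ∈ polylogRegion r := by
  intro j
  rw [oneSubExp_eq, sub_sub_cancel]
  exact Complex.ofReal_mem_slitPlane.2 (Real.exp_pos _)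

theorem prod_cpow_eq_gammaWeight {r : ℕ} {l : Fin r → ℕ} (hl : ∀ j, 0 < l j) (t : Fin r → ℝ) :
    ∏ j, (t j : ℂ) ^ ((l j : ℂ) - 1) = (∏ j, ((l j - 1)! : ℂ)) * gammaWeight l t := by
  rw [gammaWeight, Complex.ofReal_prod, ← Finset.prod_mul_distrib]
  refine Finset.prod_congr rfl fun j _ => ?_
  rw [← Nat.cast_one, ← Nat.cast_sub (hl j), Complex.cpow_natCast]
  have : ((l j - 1)! : ℂ) ≠ 0 := by exact_mod_cast Nat.factorial_ne_zero _
  push_cast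
  field_simp

/-- The prefactor ∏ z_j of the polylogarithm cancels the denominator of the integrand, and e ^ X -
z_j becomes e ^ X + e ^ T - 1. -/
theorem etaIntegrand_eq {r : ℕ} {k l : Fin r → ℕ} (hk : ∀ j, 0 < k j) (hl : ∀ j, 0 < l j)
    {t : Fin r → ℝ} (ht : t ∈ posOrthant r) :
    etaIntegrand (fun j => (k j : ℂ)) (fun j => (l j : ℂ)) t =
      (∏ j, ((l j - 1)! : ℂ)) * ((∫ x, doubleIntegrand k l (t, x) ∂orthantMeasure r : ℝ) : ℂ) := by
  have hne : ∏ j, oneSubExp t j ≠ 0 := by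
    refine Finset.prod_ne_zero_iff.2 fun j _ => ?_
    rw [oneSubExp_eq, sub_ne_zero]
    have := Real.one_lt_exp_iff.2 (tailSum_pos ht j)
    exact_mod_cast this.ne
  have h1 : ∀ x, (doubleIntegrand k l (t, x) : ℂ) =
      gammaWeight l t * polylogIntegrand k (oneSubExp t) x := by
    intro x
    simp only [doubleIntegrand, polylogIntegrand, etaKernel, oneSubExp_eq]
    push_cast
    simp only [one_div]
    have : ∀ j, Complex.exp (tailSum x j) + Complex.exp (tailSum t j) - 1 =
        Complex.exp (tailSum x j) - (1 - Complex.exp (tailSum t j)) := fun j => by ring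
    simp only [this]
    ring
  rw [etaIntegrand, polylog_eq (isPolylogContinuation_polylogIntegral hk)
    (oneSubExp_mem_polylogRegion t), polylogIntegral, mul_div_cancel_left₀ _ hne,
    prod_cpow_eq_gammaWeight hl, ← integral_complex_ofReal]
  simp_rw [h1]
  rw [integral_const_mul]
  ring

/-- Absolute convergence is Fubini applied to the integrable double integrand. -/
theorem etaWellDefined {s : ℕ} {k l : Fin (s + 1) → ℕ} (hk : ∀ j, 0 < k j) (hl : ∀ j, 0 < l j) :
    EtaWellDefined (fun j => (k j : ℂ)) (fun j => (l j : ℂ)) := by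
  refine ⟨⟨_, isPolylogContinuation_polylogIntegral hk⟩, ?_⟩
  rw [IntegrableOn, restrict_posOrthant]
  refine ((integrable_doubleIntegrand hk hl).integral_prod_left.ofReal.const_mul
    (∏ j, ((l j - 1)! : ℂ))).congr ?_
  filter_upwards [ae_mem_posOrthant (s + 1)] with t ht
  exact (etaIntegrand_eq hk hl ht).symm

/-- The value of eta at indices as a double integral. -/
theorem etaNat_eq {s : ℕ} {k l : Fin (s + 1) → ℕ} (hk : ∀ j, 0 < k j) (hl : ∀ j, 0 < l j) :
    etaNat k l = ((∫ z, doubleIntegrand k l z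
      ∂(orthantMeasure (s + 1)).prod (orthantMeasure (s + 1)) : ℝ) : ℂ) := by
  have h1 : ∀ᵐ t ∂orthantMeasure (s + 1),
      etaIntegrand (fun j => (k j : ℂ)) (fun j => (l j : ℂ)) t = (∏ j, ((l j - 1)! : ℂ)) *
        ((∫ x, doubleIntegrand k l (t, x) ∂orthantMeasure (s + 1) : ℝ) : ℂ) := by
    filter_upwards [ae_mem_posOrthant (s + 1)] with t ht using etaIntegrand_eq hk hl ht
  -- These Gamma factors cancel the factorials introduced by the normalization of `gammaWeight l`.
  have h2 : ∀ j, Complex.Gamma (l j) = ((l j - 1)! : ℂ) := by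
    intro j
    rw [← Complex.Gamma_nat_eq_factorial, Nat.cast_sub (hl j), Nat.cast_one, sub_add_cancel]
  have h3 : (∏ j, ((l j - 1)! : ℂ)) ≠ 0 :=
    Finset.prod_ne_zero_iff.2 fun j _ => by exact_mod_cast Nat.factorial_ne_zero _
  rw [etaNat, eta, restrict_posOrthant, integral_congr_ae h1, integral_const_mul,
    integral_complex_ofReal, integral_prod _ (integrable_doubleIntegrand hk hl)]
  simp only [h2, Finset.prod_inv_distrib]
  rw [← mul_assoc, inv_mul_cancel₀ h3, one_mul]

/-! ### The sum formula and its special cases -/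

theorem sum_etaNat {k l s : ℕ} (hk : s + 1 ≤ k) (hl : s + 1 ≤ l) :
    ∑ κ ∈ indexSet k (s + 1), ∑ μ ∈ indexSet l (s + 1), etaNat κ μ =
      (zetaLin (sumFormulaIndex k l (s + 1)) : ℂ) := by
  rw [← sum_integral_doubleIntegrand hk hl, Complex.ofReal_sum]
  refine Finset.sum_congr rfl fun κ hκ => ?_
  rw [Complex.ofReal_sum]
  exact Finset.sum_congr rfl fun μ hμ => etaNat_eq (mem_indexSet.1 hκ).2 (mem_indexSet.1 hμ).2

theorem sum_etaNat_mem_etaSpace (k l : ℕ) {r : ℕ} (hr : 0 < r) :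
    ∑ κ ∈ indexSet k r, ∑ μ ∈ indexSet l r, etaNat κ μ ∈ etaSpace (k + l) := by
  refine sum_mem fun κ hκ => sum_mem fun μ hμ => Submodule.subset_span ?_
  obtain ⟨h1, h2⟩ := mem_indexSet.1 hκ
  obtain ⟨h3, h4⟩ := mem_indexSet.1 hμ
  exact ⟨r, κ, μ, hr, h2, h4, by rw [h1, h3], rfl⟩

theorem indexSet_one {k : ℕ} (hk : 0 < k) : indexSet k 1 = {fun _ => k} := by
  ext f
  rw [mem_indexSet, Finset.mem_singleton, funext_iff]
  simp only [Fin.forall_fin_one, Finset.univ_unique, Finset.sum_singleton]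
  constructor
  · exact fun h => h.1
  · intro h; exact ⟨h, by omega⟩

theorem indexSet_self (r : ℕ) : indexSet r r = {fun _ => 1} := by
  ext f
  rw [mem_indexSet, Finset.mem_singleton, funext_iff]
  constructor
  · rintro ⟨h1, h2⟩ j
    have h3 := sum_sub_one h2
    have h4 : ∑ j, (f j - 1) = 0 := by omega
    have := Finset.sum_eq_zero_iff.1 h4 j (Finset.mem_univ j)
    have := h2 j
    omega
  · intro h
    simp [h]

end EtaMZV

end

open EtaMZV
theorem theorem4p2 :
    -- the values of eta at indices are well defined
    (∀ (r : ℕ) (k l : Fin r → ℕ), 0 < r → (∀ j, 0 < k j) → (∀ j, 0 < l j) →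
      EtaWellDefined (fun j => (k j : ℂ)) (fun j => (l j : ℂ))) ∧
    -- the sum formula
    (∀ k l r : ℕ, 0 < r → r ≤ k → r ≤ l →
      IsAdmissibleOfWeight (sumFormulaIndex k l r) (k + l) ∧
      ∑ κ ∈ indexSet k r, ∑ μ ∈ indexSet l r, etaNat κ μ
        = (zetaLin (sumFormulaIndex k l r) : ℂ) ∧
      HasSum (fun x : seriesRange r (k - r) (l - r) => seriesTerm x.1)
        (zetaLin (sumFormulaIndex k l r)) ∧
      ∑ κ ∈ indexSet k r, ∑ μ ∈ indexSet l r, etaNat κ μ ≠ 0 ∧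
      ∑ κ ∈ indexSet k r, ∑ μ ∈ indexSet l r, etaNat κ μ
        ∈ etaSpace (k + l) ⊓ zetaSpace (k + l)) ∧
    -- the case where all entries are 1
    (∀ r : ℕ, 0 < r →
      etaNat (fun _ : Fin r => 1) (fun _ : Fin r => 1) = (mzv (List.replicate r 2) : ℂ)) ∧
    -- the case of depth 1
    (∀ k l : ℕ, 0 < k → 0 < l →
      IsAdmissibleOfWeight (circ (starSum (List.replicate k 1)) (starSum (List.replicate l 1)))
        (k + l) ∧
      etaNat (fun _ : Fin 1 => k) (fun _ : Fin 1 => l)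
        = (zetaLin (circ (starSum (List.replicate k 1)) (starSum (List.replicate l 1))) : ℂ) ∧
      HasSum (fun x : pairRange k l => 1 / ((∏ i, (x.1.1 i : ℝ)) * ∏ j, (x.1.2 j : ℝ)))
        (zetaLin (circ (starSum (List.replicate k 1)) (starSum (List.replicate l 1))))) := by
  refine ⟨?_, ?_, ?_, ?_⟩
  · intro r k l hr hk hl
    obtain ⟨s, rfl⟩ := Nat.exists_eq_succ_of_ne_zero hr.ne'
    exact etaWellDefined hk hl
  · intro k l r hr hk hl
    obtain ⟨s, rfl⟩ := Nat.exists_eq_succ_of_ne_zero hr.ne'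
    have hα := isAdmissibleOfWeight_of_mem_supported le_rfl
      (sumFormulaIndex_mem_supported k l (s + 1) hr hk hl)
    refine ⟨hα, sum_etaNat hk hl, hasSum_seriesTerm hk hl, ?_, sum_etaNat_mem_etaSpace k l hr, ?_⟩
    · rw [sum_etaNat hk hl]
      exact_mod_cast (zetaLin_sumFormulaIndex_pos hk hl).ne'
    · rw [sum_etaNat hk hl]
      exact zetaLin_mem_zetaSpace hα
  · intro r hr
    obtain ⟨s, rfl⟩ := Nat.exists_eq_succ_of_ne_zero hr.ne'
    -- Weight equal to depth leaves the index (1, …, 1) alone on each side, so the sum is a single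
    -- value of eta.
    have h := sum_etaNat (le_refl (s + 1)) (le_refl (s + 1))
    rw [indexSet_self, Finset.sum_singleton, Finset.sum_singleton,
      zetaLin_sumFormulaIndex_self _ hr] at h
    exact h
  · intro k l hk hl
    refine ⟨isAdmissibleOfWeight_of_mem_supported le_rfl (circ_starSum_mem_supported k l hk hl),
      ?_⟩
    obtain ⟨k, rfl⟩ := Nat.exists_eq_succ_of_ne_zero hk.ne'
    obtain ⟨l, rfl⟩ := Nat.exists_eq_succ_of_ne_zero hl.ne'
    -- In depth 1 each weight has exactly one index, so the double sum is again a single value.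
    have h := sum_etaNat (s := 0) (Nat.succ_le_of_lt hk) (Nat.succ_le_of_lt hl)
    rw [zero_add, indexSet_one hk, indexSet_one hl, Finset.sum_singleton, Finset.sum_singleton,
      zetaLin_sumFormulaIndex_one] at h
    exact ⟨h, hasSum_pairRange k l⟩
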